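/- Let $N\ge 0$ and $d\ge 2$ be integers, and let $\otimes$ denote throughout either the minimal or the maximal tensor product of $C^*$-algebras (the result holds for both). All $C^*$-algebras are unital. **Spheres.** Let $C(S^{N-1}_{\mathbb R,+})$ be the universal $C^*$-algebra generated by self-adjoint elements $x_1,\dots,x_N$ with $\sum_i x_i^2=1$. The polygonal spheres are as follows, where $(P_d)$ denotes the relations $x_{i_0}x_{i_1}\cdots x_{i_d}=0$ for all pairwise distinct indices $i_0,\dots,i_d$ (no condition if $d\ge N$): - $S^{N-1,d-1}_{\mathbb R}=\{x\in\mathbb R^N : \|x\|=1,\ x_{i_0}\cdots x_{i_d}=0 \text{ for all distinct } i_0,\dots,i_d\}$, with its algebra $C(S^{N-1,d-1}_{\mathbb R})$ of continuous complex functions and the usual coordinates $x_i$. - $\bar S^{N-1,d-1}_{\mathbb R}$, $S^{N-1,d-1}_{\mathbb R,*}$, $\bar S^{N-1,d-1}_{\mathbb R,*}$, $S^{N-1,d-1}_{\mathbb R,+}$: the universal $C^*$-algebras obtained from $C(S^{N-1}_{\mathbb R,+})$ by imposing $(P_d)$ and, respectively: $x_ix_j=-x_jx_i$ for $i\ne j$;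 $x_ix_jx_k=x_kx_jx_i$ for all $i,j,k$; $x_ix_jx_k=-x_kx_jx_i$ for $i,j,k$ distinct and $x_ix_jx_k=x_kx_jx_i$ otherwise; no further relation. **Quantum groups.** A closed quantum subgroup $G\subset O_N^+$ is given by a $C^*$-algebra $C(G)$ generated by self-adjoint elements $u_{ij}$ ($1\le i,j\le N$) with $\sum_k u_{ik}u_{jk}=\sum_k u_{ki}u_{kj}=\delta_{ij}$, such that $u_{ij}\mapsto\sum_k u_{ik}\otimes u_{kj}$ defines a morphism $C(G)\to C(G)\otimes C(G)$. Consider the following ones: - $H_N$: the group of $N\times N$ signed permutation matrices, with $C(H_N)$ its algebra of functions and $u_{ij}(U)=U_{ij}$. - $H_N^*$: $C(H_N^*)$ is the universal $C^*$-algebra generated by self-adjoint $u_{ij}$ satisfying the above orthogonality relations, $abc=cba$ for all $a,b,c\in\{u_{ij}\}$, and $ab=0$ whenever $a\ne b$ are entries on the same row or the same column of $u$. - $H_N^{[\infty]}$: $C(H_N^{[\infty]})$ is the universal $C^*$-algebra generated by self-adjoint $u_{ij}$ satisfying the above orthogonality relations and $abc=0$ for all $a,b,c\in\{u_{ij}\}$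 such that $a\ne c$ are entries on the same row or the same column of $u$. We say that $G$ acts on $X$ if there is a (unital) morphism of $C^*$-algebras $\Phi:C(X)\to C(G)\otimes C(X)$ with $\Phi(x_i)=\sum_j u_{ij}\otimes x_j$ for all $i$. **Theorem.** $H_N,\ H_N,\ H_N^*,\ H_N^*,\ H_N^{[\infty]}$ act respectively on $$S^{N-1,d-1}_{\mathbb R},\quad \bar S^{N-1,d-1}_{\mathbb R},\quad S^{N-1,d-1}_{\mathbb R,*},\quad \bar S^{N-1,d-1}_{\mathbb R,*},\quad S^{N-1,d-1}_{\mathbb R,+}.$$ -/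

import Mathlib

open scoped TensorProduct

noncomputable section

/-- A C*-seminorm on a complex *-algebra. -/
structure CStarSeminorm (F : Type*) [Ring F] [StarRing F] [Algebra ℂ F] extends Seminorm ℂ F where
  mul_le' : ∀ a b : F, toFun (a * b) ≤ toFun a * toFun b
  star_mul_self' : ∀ a : F, toFun (star a * a) = toFun a ^ 2

namespace CStarSeminorm

variable {F : Type*} [Ring F] [StarRing F] [Algebra ℂ F]

instance : CoeFun (CStarSeminorm F) (fun _ => F → ℝ) := ⟨fun p => p.toFun⟩

section basic
variable (p : CStarSeminorm F)

theorem nonneg (a : F) : 0 ≤ p a := apply_nonneg p.toSeminorm a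
theorem add_le (a b : F) : p (a + b) ≤ p a + p b := map_add_le_add p.toSeminorm a b
theorem zero_eq : p 0 = 0 := map_zero p.toSeminorm
theorem neg_eq (a : F) : p (-a) = p a := map_neg_eq_map p.toSeminorm a
theorem smul_eq (c : ℂ) (a : F) : p (c • a) = ‖c‖ * p a := map_smul_eq_mul p.toSeminorm c a

theorem star_le (a : F) : p a ≤ p (star a) := by
  have h : p a * p a ≤ p (star a) * p a := by
    have := p.mul_le' (star a) a
    rw [p.star_mul_self', sq] at this
    exact this
  rcases (p.nonneg a).eq_or_lt with h0 | h0
  · rw [← h0]; exact p.nonneg _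
  · exact le_of_mul_le_mul_right h h0

theorem star_eq (a : F) : p (star a) = p a :=
  le_antisymm (by simpa using p.star_le (star a)) (p.star_le a)

end basic

/-- The pointwise supremum of a pointwise bounded set of C*-seminorms. -/
def supOf (S : Set (CStarSeminorm F)) (hS : ∀ a : F, ∃ C : ℝ, ∀ p ∈ S, p a ≤ C) :
    CStarSeminorm F where
  toFun a := ⨆ p : S, p.1 a
  map_zero' := by simp [zero_eq]
  add_le' a b := by
    have bdd (a : F) : BddAbove (Set.range fun p : S => p.1 a) := by
      obtain ⟨C, hC⟩ := hS a; exact ⟨C, by rintro _ ⟨p, rfl⟩; exact hC p p.2⟩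
    rcases isEmpty_or_nonempty S with h | h
    · simp
    · exact ciSup_le fun p => (p.1.add_le a b).trans
        (add_le_add (le_ciSup (bdd a) p) (le_ciSup (bdd b) p))
  neg' a := by simp [neg_eq]
  smul' c a := by
    simp only [smul_eq]
    rw [Real.mul_iSup_of_nonneg (norm_nonneg c)]
  mul_le' a b := by
    have bdd (a : F) : BddAbove (Set.range fun p : S => p.1 a) := by
      obtain ⟨C, hC⟩ := hS a; exact ⟨C, by rintro _ ⟨p, rfl⟩; exact hC p p.2⟩
    rcases isEmpty_or_nonempty S with h | h
    · simp
    · exact ciSup_le fun p => (p.1.mul_le' a b).trans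
        (mul_le_mul (le_ciSup (bdd a) p) (le_ciSup (bdd b) p) (p.1.nonneg b)
          ((p.1.nonneg a).trans (le_ciSup (bdd a) p)))
  star_mul_self' a := by
    have bdd (a : F) : BddAbove (Set.range fun p : S => p.1 a) := by
      obtain ⟨C, hC⟩ := hS a; exact ⟨C, by rintro _ ⟨p, rfl⟩; exact hC p p.2⟩
    rcases isEmpty_or_nonempty S with h | h
    · simp
    · have h0 : 0 ≤ ⨆ p : S, p.1 a :=
        ((Classical.arbitrary S).1.nonneg a).trans (le_ciSup (bdd a) _)
      apply le_antisymm
      · refine ciSup_le fun p => ?_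
        rw [p.1.star_mul_self']
        exact pow_le_pow_left₀ (p.1.nonneg a) (le_ciSup (bdd a) p) 2
      · have : (⨆ p : S, p.1 a) ≤ √(⨆ p : S, p.1 (star a * a)) := by
          refine ciSup_le fun p => Real.le_sqrt_of_sq_le ?_
          rw [← p.1.star_mul_self']
          exact le_ciSup (bdd (star a * a)) p
        calc _ ≤ (√(⨆ p : S, p.1 (star a * a))) ^ 2 := pow_le_pow_left₀ h0 this 2
          _ = _ := Real.sq_sqrt (((Classical.arbitrary S).1.nonneg _).trans
            (le_ciSup (bdd (star a * a)) _))

theorem le_supOf {S : Set (CStarSeminorm F)} {hS : ∀ a : F, ∃ C : ℝ, ∀ p ∈ S, p a ≤ C}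
    {p : CStarSeminorm F} (hp : p ∈ S) (a : F) : p a ≤ supOf S hS a := by
  obtain ⟨C, hC⟩ := hS a
  exact le_ciSup (f := fun p : S => p.1 a) ⟨C, by rintro _ ⟨p, rfl⟩; exact hC p p.2⟩ ⟨p, hp⟩

/-- The C*-seminorm `a ↦ ‖φ a‖` defined by a *-homomorphism into a C*-algebra. -/
def ofHom {T : Type*} [CStarAlgebra T] (φ : F →⋆ₐ[ℂ] T) : CStarSeminorm F where
  toFun a := ‖φ a‖
  map_zero' := by simp
  add_le' a b := by simpa using norm_add_le _ _
  neg' a := by simp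
  smul' c a := by simp [norm_smul]
  mul_le' a b := by simpa using norm_mul_le _ _
  star_mul_self' a := by rw [map_mul, map_star, CStarRing.norm_star_mul_self, sq]

@[simp] theorem ofHom_apply {T : Type*} [CStarAlgebra T] (φ : F →⋆ₐ[ℂ] T) (a : F) :
    ofHom φ a = ‖φ a‖ := rfl

/-- The algebra `F`, regarded as a seminormed space by means of `p`. -/
def Pre (_ : CStarSeminorm F) : Type _ := F

section pre
variable (p : CStarSeminorm F)

instance : Ring p.Pre := inferInstanceAs (Ring F)
instance : StarRing p.Pre := inferInstanceAs (StarRing F)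
instance : Algebra ℂ p.Pre := inferInstanceAs (Algebra ℂ F)
instance [StarModule ℂ F] : StarModule ℂ p.Pre := inferInstanceAs (StarModule ℂ F)

instance : SeminormedRing p.Pre where
  __ : Ring p.Pre := inferInstance
  __ := p.toSeminorm.toAddGroupSeminorm.toSeminormedAddCommGroup
  norm_mul_le := p.mul_le'

theorem norm_pre (a : p.Pre) : ‖a‖ = p a := rfl

instance : NormedSpace ℂ p.Pre where
  norm_smul_le c a := (p.smul_eq c a).le

instance : NormedStarGroup p.Pre where
  norm_star_le a := (p.star_eq a).le

/-- The C*-algebra obtained from `F` by separation and completion with respect to the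
C*-seminorm `p`. -/
def Cpl : Type _ := UniformSpace.Completion p.Pre

instance : NormedRing p.Cpl := inferInstanceAs (NormedRing (UniformSpace.Completion p.Pre))
instance : CompleteSpace p.Cpl := inferInstanceAs (CompleteSpace (UniformSpace.Completion p.Pre))
instance : Algebra ℂ p.Cpl := inferInstanceAs (Algebra ℂ (UniformSpace.Completion p.Pre))
instance : NormedAlgebra ℂ p.Cpl where
  norm_smul_le c x := norm_smul_le (β := UniformSpace.Completion p.Pre) c x

instance : Star p.Cpl := ⟨UniformSpace.Completion.map (star : p.Pre → p.Pre)⟩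

theorem uniformContinuous_star_pre : UniformContinuous (star : p.Pre → p.Pre) :=
  (starNormedAddGroupHom : NormedAddGroupHom p.Pre p.Pre).uniformContinuous

/-- The canonical map of `F` into its completion. -/
def coe' (a : F) : p.Cpl := UniformSpace.Completion.coe' (α := p.Pre) a

theorem continuous_star_cpl : Continuous (star : p.Cpl → p.Cpl) :=
  UniformSpace.Completion.continuous_map

theorem star_coe' (a : F) : star (p.coe' a) = p.coe' (star a) :=
  UniformSpace.Completion.map_coe p.uniformContinuous_star_pre a

theorem denseRange_coe' : DenseRange p.coe' :=
  UniformSpace.Completion.denseRange_coe (α := p.Pre)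

theorem norm_coe' (a : F) : ‖p.coe' a‖ = p a :=
  UniformSpace.Completion.norm_coe (E := p.Pre) a

theorem coe'_add (a b : F) : p.coe' (a + b) = p.coe' a + p.coe' b :=
  UniformSpace.Completion.coe_add (α := p.Pre) a b

theorem coe'_mul (a b : F) : p.coe' (a * b) = p.coe' a * p.coe' b :=
  UniformSpace.Completion.coe_mul (α := p.Pre) a b

theorem coe'_smul (c : ℂ) (a : F) : p.coe' (c • a) = c • p.coe' a :=
  UniformSpace.Completion.coe_smul (X := p.Pre) c a

theorem coe'_one : p.coe' 1 = 1 := rfl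

instance : StarRing p.Cpl where
  star_involutive x := by
    induction x using p.denseRange_coe'.induction_on with
    | hp => exact isClosed_eq (p.continuous_star_cpl.comp p.continuous_star_cpl) continuous_id
    | ih a => rw [star_coe', star_coe', star_star]
  star_mul x y := by
    induction x, y using p.denseRange_coe'.induction_on₂ with
    | hp =>
      exact isClosed_eq (p.continuous_star_cpl.comp continuous_mul)
        ((p.continuous_star_cpl.comp continuous_snd).mul (p.continuous_star_cpl.comp continuous_fst))
    | h a b => rw [← coe'_mul, star_coe', star_coe', star_coe', star_mul, coe'_mul]
  star_add x y := by
    induction x, y using p.denseRange_coe'.induction_on₂ with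
    | hp =>
      exact isClosed_eq (p.continuous_star_cpl.comp continuous_add)
        ((p.continuous_star_cpl.comp continuous_fst).add (p.continuous_star_cpl.comp continuous_snd))
    | h a b => rw [← coe'_add, star_coe', star_coe', star_coe', star_add, coe'_add]

instance : CStarRing p.Cpl where
  norm_mul_self_le x := by
    refine le_of_eq ?_
    induction x using p.denseRange_coe'.induction_on with
    | hp =>
      exact isClosed_eq (continuous_norm.mul continuous_norm)
        (continuous_norm.comp (p.continuous_star_cpl.mul continuous_id))
    | ih a => rw [star_coe', ← coe'_mul, norm_coe', norm_coe', p.star_mul_self', sq]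

instance [StarModule ℂ F] : StarModule ℂ p.Cpl where
  star_smul c x := by
    induction x using p.denseRange_coe'.induction_on with
    | hp =>
      exact isClosed_eq (p.continuous_star_cpl.comp (continuous_const_smul c))
        (p.continuous_star_cpl.const_smul (star c))
    | ih a => rw [← coe'_smul, star_coe', star_smul, star_coe', coe'_smul]

instance [StarModule ℂ F] : CStarAlgebra p.Cpl where

/-- The canonical *-homomorphism of `F` into its completion. -/
def of : F →⋆ₐ[ℂ] p.Cpl where
  toFun := p.coe'
  map_one' := rfl
  map_zero' := rfl
  map_mul' := p.coe'_mul
  map_add' := p.coe'_add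
  commutes' c := by
    rw [Algebra.algebraMap_eq_smul_one, coe'_smul, coe'_one, Algebra.algebraMap_eq_smul_one]
  map_star' a := (p.star_coe' a).symm

theorem norm_of (a : F) : ‖p.of a‖ = p a := p.norm_coe' a

theorem denseRange_of : DenseRange p.of := p.denseRange_coe'

/-- A *-homomorphism into a C*-algebra that is bounded by `p` extends to the completion. -/
theorem exists_extension {T : Type*} [CStarAlgebra T] (φ : F →⋆ₐ[ℂ] T) (h : ∀ a, ‖φ a‖ ≤ p a) :
    ∃ Φ : p.Cpl →⋆ₐ[ℂ] T, ∀ a, Φ (p.of a) = φ a := by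
  let φ' : p.Pre →+* T := (φ : F →ₐ[ℂ] T).toRingHom
  have hφ' : Continuous φ' :=
    AddMonoidHomClass.continuous_of_bound φ' 1 (fun a => by rw [one_mul]; exact h a)
  let Φ : p.Cpl →+* T := UniformSpace.Completion.extensionHom φ' hφ'
  have hc : Continuous Φ := UniformSpace.Completion.continuous_extension
  have hΦ (a : F) : Φ (p.coe' a) = φ a := UniformSpace.Completion.extensionHom_coe φ' hφ' a
  refine ⟨{ Φ with commutes' := fun c => ?_, map_star' := fun x => ?_ }, hΦ⟩
  · have : algebraMap ℂ p.Cpl c = p.coe' (algebraMap ℂ F c) := (p.of.commutes' c).symm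
    change Φ _ = _
    rw [this, hΦ, AlgHomClass.commutes]
  · change Φ (star x) = star (Φ x)
    induction x using p.denseRange_coe'.induction_on with
    | hp => exact isClosed_eq (hc.comp p.continuous_star_cpl) (continuous_star.comp hc)
    | ih a => rw [star_coe', hΦ, hΦ, map_star]
end pre
end CStarSeminorm

/-! ### C*-tensor products -/

section tensor

variable {A B : Type} [CStarAlgebra A] [CStarAlgebra B]

theorem CStarSeminorm.exists_bound_tensor (t : A ⊗[ℂ] B) :
    ∃ C : ℝ, ∀ p : CStarSeminorm (A ⊗[ℂ] B), p t ≤ C := by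
  induction t using TensorProduct.induction_on with
  | zero => exact ⟨0, fun p => p.zero_eq.le⟩
  | add s t hs ht =>
    obtain ⟨C, hC⟩ := hs
    obtain ⟨D, hD⟩ := ht
    exact ⟨C + D, fun p => (p.add_le s t).trans (add_le_add (hC p) (hD p))⟩
  | tmul a b =>
    refine ⟨‖a‖ * ‖b‖, fun p => ?_⟩
    let φ : A →⋆ₐ[ℂ] p.Cpl := p.of.comp
      { (Algebra.TensorProduct.includeLeft : A →ₐ[ℂ] A ⊗[ℂ] B) with
        map_star' := fun a => by simp }
    let ψ : B →⋆ₐ[ℂ] p.Cpl := p.of.comp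
      { (Algebra.TensorProduct.includeRight : B →ₐ[ℂ] A ⊗[ℂ] B) with
        map_star' := fun b => by simp }
    have hφ : ‖φ a‖ ≤ ‖a‖ := NonUnitalStarAlgHom.norm_apply_le φ a
    have hψ : ‖ψ b‖ ≤ ‖b‖ := NonUnitalStarAlgHom.norm_apply_le ψ b
    have : p.of (a ⊗ₜ[ℂ] b) = φ a * ψ b := by
      change _ = p.of (a ⊗ₜ[ℂ] 1) * p.of (1 ⊗ₜ[ℂ] b)
      rw [← map_mul, Algebra.TensorProduct.tmul_mul_tmul, one_mul, mul_one]
    rw [← p.norm_of, this]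
    exact (norm_mul_le _ _).trans (mul_le_mul hφ hψ (norm_nonneg _) (norm_nonneg _))

section hilbert

variable {H K : Type} [NormedAddCommGroup H] [InnerProductSpace ℂ H] [CompleteSpace H]
  [NormedAddCommGroup K] [InnerProductSpace ℂ K] [CompleteSpace K]

variable (H K) in
/-- The algebraic tensor product of two Hilbert spaces with the inner product determined by
`⟪x ⊗ y, x' ⊗ y'⟫ = ⟪x, x'⟫ ⟪y, y'⟫`. Its completion is the Hilbert space tensor product. -/
def HilbertTensor : Type := H ⊗[ℂ] K

instance : NormedAddCommGroup (HilbertTensor H K) := inferInstanceAs (NormedAddCommGroup (H ⊗[ℂ] K))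
instance : InnerProductSpace ℂ (HilbertTensor H K) :=
  inferInstanceAs (InnerProductSpace ℂ (H ⊗[ℂ] K))

/-- The bounded operator `x ⊗ y ↦ f x ⊗ g y`. -/
def HilbertTensor.map (f : H →L[ℂ] H) (g : K →L[ℂ] K) :
    HilbertTensor H K →L[ℂ] HilbertTensor H K := TensorProduct.mapL f g

/-- The tensor product `π ⊗ ρ` of two representations by bounded operators on Hilbert spaces,
acting on the (not completed) tensor product of the Hilbert spaces. The operator norm is not
affected by passing to the completion. -/
def tensorRep (π : A →⋆ₐ[ℂ] (H →L[ℂ] H)) (ρ : B →⋆ₐ[ℂ] (K →L[ℂ] K)) :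
    A ⊗[ℂ] B →ₐ[ℂ] (HilbertTensor H K →L[ℂ] HilbertTensor H K) :=
  Algebra.TensorProduct.lift
    (AlgHom.ofLinearMap
      { toFun := fun a => HilbertTensor.map (π a) 1
        map_add' := fun a b => by
          rw [map_add]; exact TensorProduct.mapL_add_left _ _ _
        map_smul' := fun c a => by
          rw [map_smul]; exact TensorProduct.mapL_smul_left _ _ _ }
      (by
        change HilbertTensor.map (π 1) 1 = 1
        rw [map_one]; exact TensorProduct.mapL_id_id)
      (fun a b => by
        change HilbertTensor.map (π (a * b)) 1 = _
        rw [map_mul, ← one_mul (1 : K →L[ℂ] K)]; exact TensorProduct.mapL_mul _ _ _ _))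
    (AlgHom.ofLinearMap
      { toFun := fun b => HilbertTensor.map 1 (ρ b)
        map_add' := fun a b => by
          rw [map_add]; exact TensorProduct.mapL_add_right _ _ _
        map_smul' := fun c a => by
          rw [map_smul]; exact TensorProduct.mapL_smul_right _ _ _ }
      (by
        change HilbertTensor.map 1 (ρ 1) = 1
        rw [map_one]; exact TensorProduct.mapL_id_id)
      (fun a b => by
        change HilbertTensor.map 1 (ρ (a * b)) = _
        rw [map_mul, ← one_mul (1 : H →L[ℂ] H)]; exact TensorProduct.mapL_mul _ _ _ _))
    (fun a b => by
      change HilbertTensor.map (π a) 1 * HilbertTensor.map 1 (ρ b) =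
        HilbertTensor.map 1 (ρ b) * HilbertTensor.map (π a) 1
      have h₁ : HilbertTensor.map (π a) 1 * HilbertTensor.map 1 (ρ b) =
        HilbertTensor.map (π a * 1) (1 * ρ b) := (TensorProduct.mapL_mul _ _ _ _).symm
      have h₂ : HilbertTensor.map 1 (ρ b) * HilbertTensor.map (π a) 1 =
        HilbertTensor.map (1 * π a) (ρ b * 1) := (TensorProduct.mapL_mul _ _ _ _).symm
      rw [h₁, h₂, one_mul, one_mul, mul_one, mul_one])

theorem tensorRep_tmul (π : A →⋆ₐ[ℂ] (H →L[ℂ] H)) (ρ : B →⋆ₐ[ℂ] (K →L[ℂ] K))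
    (a : A) (b : B) :
    tensorRep π ρ (a ⊗ₜ b) = HilbertTensor.map (π a) (ρ b) := by
  have h : HilbertTensor.map (π a) 1 * HilbertTensor.map 1 (ρ b) =
    HilbertTensor.map (π a * 1) (1 * ρ b) := (TensorProduct.mapL_mul _ _ _ _).symm
  rw [one_mul, mul_one] at h
  rw [← h]
  exact Algebra.TensorProduct.lift_tmul _ _ _ _ _

theorem inner_tensor_map (f : H →L[ℂ] H) (g : K →L[ℂ] K) (x y : H ⊗[ℂ] K) :
    inner ℂ (TensorProduct.map f.toLinearMap g.toLinearMap x) y =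
      inner ℂ x (TensorProduct.map (star f).toLinearMap (star g).toLinearMap y) := by
  induction x using TensorProduct.induction_on with
  | zero => simp
  | add s t hs ht => simp only [map_add, inner_add_left, hs, ht]
  | tmul x x' =>
    induction y using TensorProduct.induction_on with
    | zero => simp
    | add s t hs ht => simp only [map_add, inner_add_right, hs, ht]
    | tmul y y' =>
      rw [TensorProduct.map_tmul, TensorProduct.map_tmul, TensorProduct.inner_tmul,
        TensorProduct.inner_tmul, ContinuousLinearMap.star_eq_adjoint,
        ContinuousLinearMap.star_eq_adjoint]
      simp [ContinuousLinearMap.adjoint_inner_right]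

theorem HilbertTensor.inner_map (f : H →L[ℂ] H) (g : K →L[ℂ] K) (x y : HilbertTensor H K) :
    inner ℂ (HilbertTensor.map f g x) y = inner ℂ x (HilbertTensor.map (star f) (star g) y) := by
  have h₁ : HilbertTensor.map f g x =
      (TensorProduct.map f.toLinearMap g.toLinearMap x : H ⊗[ℂ] K) :=
    TensorProduct.mapL_apply f g x
  have h₂ : HilbertTensor.map (star f) (star g) y =
      (TensorProduct.map (star f).toLinearMap (star g).toLinearMap y : H ⊗[ℂ] K) :=
    TensorProduct.mapL_apply _ _ y
  rw [h₁, h₂]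
  exact inner_tensor_map f g x y

theorem inner_tensorRep (π : A →⋆ₐ[ℂ] (H →L[ℂ] H)) (ρ : B →⋆ₐ[ℂ] (K →L[ℂ] K))
    (t : A ⊗[ℂ] B) (x y : HilbertTensor H K) :
    inner ℂ (tensorRep π ρ t x) y = inner ℂ x (tensorRep π ρ (star t) y) := by
  induction t using TensorProduct.induction_on with
  | zero => simp
  | add s t hs ht =>
    simp only [map_add, star_add, add_apply, inner_add_left, inner_add_right, hs, ht]
  | tmul a b =>
    rw [TensorProduct.star_tmul, tensorRep_tmul, tensorRep_tmul, map_star, map_star,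
      HilbertTensor.inner_map]

/-- The C*-seminorm `t ↦ ‖(π ⊗ ρ)(t)‖` on the algebraic tensor product. -/
def repSeminorm (π : A →⋆ₐ[ℂ] (H →L[ℂ] H)) (ρ : B →⋆ₐ[ℂ] (K →L[ℂ] K)) :
    CStarSeminorm (A ⊗[ℂ] B) where
  toFun t := ‖tensorRep π ρ t‖
  map_zero' := by simp
  add_le' s t := by rw [map_add]; exact norm_add_le _ _
  neg' t := by simp
  smul' c t := by rw [map_smul, norm_smul]
  mul_le' s t := by rw [map_mul]; exact norm_mul_le _ _
  star_mul_self' t := by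
    have key (s : A ⊗[ℂ] B) :
        ‖tensorRep π ρ s‖ * ‖tensorRep π ρ s‖ ≤ ‖tensorRep π ρ (star s * s)‖ := by
      refine (Real.le_sqrt (norm_nonneg _) (norm_nonneg _)).1 ?_ |>.trans' (by rw [sq])
      refine ContinuousLinearMap.opNorm_le_bound _ (Real.sqrt_nonneg _) fun x => ?_
      refine le_of_sq_le_sq ?_ (by positivity)
      rw [mul_pow, Real.sq_sqrt (norm_nonneg _), ← inner_self_eq_norm_sq (𝕜 := ℂ), inner_tensorRep,
        ← mul_apply_eq_comp, ← map_mul]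
      calc RCLike.re (inner ℂ x (tensorRep π ρ (star s * s) x))
          ≤ ‖inner ℂ x (tensorRep π ρ (star s * s) x)‖ := RCLike.re_le_norm _
        _ ≤ ‖x‖ * ‖tensorRep π ρ (star s * s) x‖ := norm_inner_le_norm _ _
        _ ≤ ‖x‖ * (‖tensorRep π ρ (star s * s)‖ * ‖x‖) := by
          gcongr; exact ContinuousLinearMap.le_opNorm _ _
        _ = _ := by ring
    have le_star (s : A ⊗[ℂ] B) : ‖tensorRep π ρ s‖ ≤ ‖tensorRep π ρ (star s)‖ := by
      rcases (norm_nonneg (tensorRep π ρ s)).eq_or_lt with h0 | h0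
      · rw [← h0]; exact norm_nonneg _
      · refine le_of_mul_le_mul_right ((key s).trans ?_) h0
        rw [map_mul]; exact norm_mul_le _ _
    refine le_antisymm ?_ (by rw [sq]; exact key t)
    rw [map_mul, sq]
    refine (norm_mul_le _ _).trans ?_
    gcongr
    simpa using le_star (star t)

end hilbert

variable (A B)

/-- The minimal (spatial) C*-norm: the supremum of `‖(π ⊗ ρ)(t)‖` over all representations `π` of
`A` and `ρ` of `B` on Hilbert spaces. -/
def minSeminorm : CStarSeminorm (A ⊗[ℂ] B) :=
  CStarSeminorm.supOf
    {p | ∃ (H K : Type) (_ : NormedAddCommGroup H) (_ : InnerProductSpace ℂ H)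
      (_ : CompleteSpace H) (_ : NormedAddCommGroup K) (_ : InnerProductSpace ℂ K)
      (_ : CompleteSpace K) (π : A →⋆ₐ[ℂ] (H →L[ℂ] H)) (ρ : B →⋆ₐ[ℂ] (K →L[ℂ] K)),
      p = repSeminorm π ρ}
    fun t => (CStarSeminorm.exists_bound_tensor t).imp fun _ h p _ => h p

/-- The maximal C*-norm: the supremum of all C*-seminorms on the algebraic tensor product. -/
def maxSeminorm : CStarSeminorm (A ⊗[ℂ] B) :=
  CStarSeminorm.supOf Set.univ
    fun t => (CStarSeminorm.exists_bound_tensor t).imp fun _ h p _ => h p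

/-- The two standard conventions for the tensor product of C*-algebras. -/
inductive TensorKind
  | minimal
  | maximal

/-- The C*-norm of the chosen C*-tensor product. -/
def TensorKind.seminorm : TensorKind → CStarSeminorm (A ⊗[ℂ] B)
  | .minimal => minSeminorm A B
  | .maximal => maxSeminorm A B

/-- The tensor product of two (unital) C*-algebras: the completion of the algebraic tensor product with
respect to the chosen C*-norm. -/
abbrev TensorKind.tensor (τ : TensorKind) : Type := (τ.seminorm A B).Cpl

variable {A B}

/-- The elementary tensor `a ⊗ b` in the C*-tensor product. -/
def TensorKind.tmul (τ : TensorKind) (a : A) (b : B) : τ.tensor A B :=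
  (τ.seminorm A B).of (a ⊗ₜ[ℂ] b)

end tensor

/-! ### Noncommutative polynomials and universal C*-algebras -/

/-- Noncommutative polynomials in the variables `X i`, which are self-adjoint for the *-operation
defined below. -/
abbrev NCPoly (I : Type) : Type := MonoidAlgebra ℂ (FreeMonoid I)

namespace NCPoly

variable {I : Type}

/-- The variables. -/
def X (i : I) : NCPoly I := MonoidAlgebra.of ℂ (FreeMonoid I) (FreeMonoid.of i)

/-- The *-operation reverses words and conjugates coefficients. -/
def starAux : NCPoly I →+ NCPoly I :=
  MonoidAlgebra.liftNC ((algebraMap ℂ (NCPoly I)).comp (starRingEnd ℂ)).toAddMonoidHom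
    (fun w => MonoidAlgebra.of ℂ (FreeMonoid I) (star w))

theorem starAux_single (w : FreeMonoid I) (c : ℂ) :
    starAux (MonoidAlgebra.single w c) = MonoidAlgebra.single (star w) (starRingEnd ℂ c) := by
  rw [starAux, MonoidAlgebra.liftNC_single]
  simp

instance : StarRing (NCPoly I) where
  star := starAux
  star_involutive f := by
    induction f using MonoidAlgebra.induction_linear with
    | zero => simp
    | add f g hf hg => simp only [map_add, hf, hg]
    | single w c => simp [starAux_single]
  star_mul f g := by
    induction f using MonoidAlgebra.induction_linear with
    | zero => simp
    | add f f' hf hf' => rw [add_mul, map_add, hf, hf', map_add, mul_add]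
    | single w c =>
      induction g using MonoidAlgebra.induction_linear with
      | zero => simp
      | add f f' hf hf' => rw [mul_add, map_add, hf, hf', map_add, add_mul]
      | single v d =>
        rw [MonoidAlgebra.single_mul_single, starAux_single, starAux_single, starAux_single,
          MonoidAlgebra.single_mul_single, star_mul, map_mul, mul_comm (starRingEnd ℂ c)]
  star_add f g := map_add _ _ _

theorem star_single (w : FreeMonoid I) (c : ℂ) :
    star (MonoidAlgebra.single w c : NCPoly I) = MonoidAlgebra.single (star w) (starRingEnd ℂ c) :=
  starAux_single w c

@[simp] theorem star_X (i : I) : star (X i) = X i := by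
  rw [X, MonoidAlgebra.of_apply, star_single]; simp

instance : StarModule ℂ (NCPoly I) where
  star_smul c f := by
    induction f using MonoidAlgebra.induction_linear with
    | zero => simp
    | add f g hf hg => rw [smul_add, star_add, hf, hg, star_add, smul_add]
    | single w d => rw [MonoidAlgebra.smul_single, star_single, star_single]; simp

/-- Evaluation of noncommutative polynomials at self-adjoint elements. -/
def eval {T : Type*} [Ring T] [StarRing T] [Algebra ℂ T] [StarModule ℂ T] (y : I → T)
    (hy : ∀ i, star (y i) = y i) : NCPoly I →⋆ₐ[ℂ] T :=
  { MonoidAlgebra.lift ℂ T (FreeMonoid I) (FreeMonoid.lift y) with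
    map_star' := fun f => by
      have hw (w : FreeMonoid I) : FreeMonoid.lift y (star w) = star (FreeMonoid.lift y w) := by
        induction w using FreeMonoid.inductionOn' with
        | one => simp
        | of_mul i w ih => rw [star_mul, map_mul, map_mul, star_mul, ih]; simp [hy]
      change MonoidAlgebra.lift ℂ T (FreeMonoid I) (FreeMonoid.lift y) (star f) =
        star (MonoidAlgebra.lift ℂ T (FreeMonoid I) (FreeMonoid.lift y) f)
      induction f using MonoidAlgebra.induction_linear with
      | zero => simp
      | add f g hf hg => rw [star_add, map_add, map_add, star_add, hf, hg]
      | single w c =>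
        rw [star_single, MonoidAlgebra.lift_single, MonoidAlgebra.lift_single, hw, star_smul]
        rfl }

@[simp] theorem eval_X {T : Type*} [Ring T] [StarRing T] [Algebra ℂ T] [StarModule ℂ T]
    (y : I → T) (hy : ∀ i, star (y i) = y i) (i : I) : eval y hy (X i) = y i := by
  change MonoidAlgebra.lift ℂ T (FreeMonoid I) (FreeMonoid.lift y) (X i) = y i
  simp [X]

theorem adjoin_X : StarAlgebra.adjoin ℂ (Set.range (X : I → NCPoly I)) = ⊤ := by
  rw [eq_top_iff]
  rintro f -
  induction f using MonoidAlgebra.induction_linear with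
  | zero => exact zero_mem _
  | add f g hf hg => exact add_mem hf hg
  | single w c =>
    have : (MonoidAlgebra.single w c : NCPoly I) = c • MonoidAlgebra.of ℂ (FreeMonoid I) w := by
      simp
    rw [this]
    refine SMulMemClass.smul_mem c ?_
    induction w using FreeMonoid.inductionOn' with
    | one => rw [map_one]; exact one_mem _
    | of_mul i w ih =>
      rw [map_mul]
      refine mul_mem (StarAlgebra.subset_adjoin ℂ _ ⟨i, rfl⟩) (ih ?_)
      simp

end NCPoly

open NCPoly

section universal

variable {I : Type}

/-- The set of relations `P = 0`, `P ∈ R`, between self-adjoint variables bounds all the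
C*-seminorms, so that the corresponding universal C*-algebra exists. -/
def IsBoundedRel (R : Set (NCPoly I)) : Prop :=
  ∀ f : NCPoly I, ∃ C : ℝ, ∀ p ∈ {p : CStarSeminorm (NCPoly I) | ∀ P ∈ R, p P = 0}, p f ≤ C

/-- The universal C*-algebra generated by self-adjoint variables `X i` with the relations `P = 0`,
`P ∈ R`: the completion with respect to the largest C*-seminorm vanishing on `R`. -/
abbrev UniversalCStar (R : Set (NCPoly I)) (hR : IsBoundedRel R) : Type :=
  (CStarSeminorm.supOf {p : CStarSeminorm (NCPoly I) | ∀ P ∈ R, p P = 0} hR).Cpl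

/-- The standard generators of the universal C*-algebra. -/
def UniversalCStar.gen (R : Set (NCPoly I)) (hR : IsBoundedRel R) (i : I) : UniversalCStar R hR :=
  (CStarSeminorm.supOf _ hR).of (X i)

variable {R : Set (NCPoly I)} {hR : IsBoundedRel R}

theorem UniversalCStar.star_gen (i : I) : star (gen R hR i) = gen R hR i := by
  rw [gen, ← map_star, star_X]

theorem NCPoly.eval_gen (f : NCPoly I) :
    eval (UniversalCStar.gen R hR) UniversalCStar.star_gen f = (CStarSeminorm.supOf _ hR).of f := by
  have hf : f ∈ StarAlgebra.adjoin ℂ (Set.range (X : I → NCPoly I)) := by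
    rw [adjoin_X]; trivial
  have hle : StarAlgebra.adjoin ℂ (Set.range (X : I → NCPoly I)) ≤
      StarAlgHom.equalizer (eval (UniversalCStar.gen R hR) UniversalCStar.star_gen)
        (CStarSeminorm.supOf _ hR).of := by
    rw [StarAlgebra.adjoin_le_iff]
    rintro _ ⟨i, rfl⟩
    exact eval_X _ UniversalCStar.star_gen i
  exact hle hf

theorem UniversalCStar.relation {P : NCPoly I} (hP : P ∈ R) :
    eval (gen R hR) star_gen P = 0 := by
  rw [eval_gen, ← norm_eq_zero, CStarSeminorm.norm_of]
  refine le_antisymm ?_ (CStarSeminorm.nonneg _ _)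
  exact Real.iSup_le (fun p => (p.2 P hP).le) le_rfl

/-- The universal property. -/
theorem UniversalCStar.exists_lift {T : Type*} [CStarAlgebra T] (y : I → T)
    (hy : ∀ i, star (y i) = y i) (h : ∀ P ∈ R, eval y hy P = 0) :
    ∃ Φ : UniversalCStar R hR →⋆ₐ[ℂ] T, ∀ i, Φ (gen R hR i) = y i := by
  obtain ⟨Φ, hΦ⟩ := CStarSeminorm.exists_extension (CStarSeminorm.supOf _ hR) (eval y hy)
    (fun f => CStarSeminorm.le_supOf (p := CStarSeminorm.ofHom (eval y hy))
      (fun P hP => by simp [h P hP]) f)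
  exact ⟨Φ, fun i => (hΦ _).trans (eval_X y hy i)⟩

theorem UniversalCStar.generates :
    (StarAlgebra.adjoin ℂ (Set.range (gen R hR))).topologicalClosure = ⊤ := by
  have h1 : StarAlgebra.adjoin ℂ (Set.range (gen R hR)) =
      (⊤ : StarSubalgebra ℂ (NCPoly I)).map (CStarSeminorm.supOf _ hR).of := by
    rw [← adjoin_X, StarAlgHom.map_adjoin, ← Set.range_comp]; rfl
  rw [h1, eq_top_iff]
  intro x _
  change x ∈ closure _
  have := (CStarSeminorm.supOf _ hR).denseRange_of x
  refine closure_mono ?_ this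
  rintro _ ⟨f, rfl⟩
  exact ⟨f, trivial, rfl⟩

theorem isBoundedRel_of_sq (R : Set (NCPoly I))
    (h : ∀ i : I, ∃ s : Finset I, i ∈ s ∧ ∑ j ∈ s, X j * X j - 1 ∈ R) : IsBoundedRel R := by
  have hX (i : I) (p : CStarSeminorm (NCPoly I)) (hp : ∀ P ∈ R, p P = 0) : p (X i) ≤ 1 := by
    obtain ⟨s, hi, hs⟩ := h i
    let := CStarAlgebra.spectralOrder p.Cpl
    let := CStarAlgebra.spectralOrderedRing p.Cpl
    have h1 : ∑ j ∈ s, p.of (X j) * p.of (X j) = 1 := by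
      have := hp _ hs
      rw [← p.norm_of, norm_eq_zero, map_sub, map_sum, map_one, sub_eq_zero] at this
      simpa using this
    have hsa (j : I) : star (p.of (X j)) = p.of (X j) := by rw [← map_star, star_X]
    have hpos (j : I) : 0 ≤ p.of (X j) * p.of (X j) := by
      have := star_mul_self_nonneg (p.of (X j)); rwa [hsa] at this
    have h2 : p.of (X i) * p.of (X i) ≤ 1 := by
      rw [← h1]
      exact Finset.single_le_sum (f := fun j => p.of (X j) * p.of (X j)) (fun j _ => hpos j) hi
    have h3 : ‖p.of (X i) * p.of (X i)‖ ≤ 1 :=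
      (CStarAlgebra.norm_le_one_iff_of_nonneg _ (hpos i)).2 h2
    have h4 : ‖p.of (X i)‖ * ‖p.of (X i)‖ ≤ 1 := by
      rw [← CStarRing.norm_star_mul_self, hsa]; exact h3
    rw [← p.norm_of]
    nlinarith [norm_nonneg (p.of (X i))]
  have h1 : ∃ C : ℝ, ∀ p : CStarSeminorm (NCPoly I), p 1 ≤ C := by
    refine ⟨1, fun p => ?_⟩
    have := p.star_mul_self' 1
    rw [star_one, one_mul] at this
    nlinarith [p.nonneg 1]
  intro f
  induction f using MonoidAlgebra.induction_linear with
  | zero => exact ⟨0, fun p _ => p.zero_eq.le⟩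
  | add f g hf hg =>
    obtain ⟨C, hC⟩ := hf
    obtain ⟨D, hD⟩ := hg
    exact ⟨C + D, fun p hp => (p.add_le f g).trans (add_le_add (hC p hp) (hD p hp))⟩
  | single w c =>
    have hw : ∀ p ∈ {p : CStarSeminorm (NCPoly I) | ∀ P ∈ R, p P = 0},
        p (MonoidAlgebra.of ℂ (FreeMonoid I) w) ≤ 1 := by
      intro p hp
      induction w using FreeMonoid.inductionOn' with
      | one =>
        rw [map_one]
        have := p.star_mul_self' 1
        rw [star_one, one_mul] at this
        nlinarith [p.nonneg 1]
      | of_mul i w ih =>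
        rw [map_mul]
        refine (p.mul_le' _ _).trans ?_
        exact mul_le_one₀ (hX i p hp) (p.nonneg _) ih
    refine ⟨‖c‖, fun p hp => ?_⟩
    have : (MonoidAlgebra.single w c : NCPoly I) = c • MonoidAlgebra.of ℂ (FreeMonoid I) w := by
      simp
    rw [this, p.smul_eq]
    exact mul_le_of_le_one_right (norm_nonneg c) (hw p hp)

end universal

/-! ### Closed subspaces of the free real sphere -/

/-- A closed noncommutative subspace `X` of the free real sphere: a quotient of the universal
C*-algebra generated by self-adjoint `x 1, …, x N` with `∑ x i ^ 2 = 1`, given as the C*-algebra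
`C(X)` together with the standard coordinates. -/
structure SphereSubspace (N : ℕ) where
  alg : Type
  [cstar : CStarAlgebra alg]
  x : Fin N → alg
  star_x : ∀ i, star (x i) = x i
  sum_sq : ∑ i, x i * x i = 1
  generates : (StarAlgebra.adjoin ℂ (Set.range x)).topologicalClosure = ⊤

attribute [instance] SphereSubspace.cstar

section relations

variable (N d : ℕ)

/-- `∑ x i ^ 2 = 1`. -/
def sphereRel : Set (NCPoly (Fin N)) := {∑ i, X i * X i - 1}

/-- `x i₀ ⋯ x i_d = 0` for `i₀, …, i_d` distinct. -/
def polygonalRel : Set (NCPoly (Fin N)) :=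
  {P | ∃ i : Fin (d + 1) → Fin N, Function.Injective i ∧ P = (List.ofFn fun k => X (i k)).prod}

/-- `x i x j = - x j x i` for `i ≠ j`. -/
def anticommRel : Set (NCPoly (Fin N)) :=
  {P | ∃ i j, i ≠ j ∧ P = X i * X j + X j * X i}

/-- `a b c = c b a` for all variables `a, b, c`. -/
def halfCommRel (I : Type) : Set (NCPoly I) :=
  {P | ∃ a b c : I, P = X a * X b * X c - X c * X b * X a}

/-- `x i x j x k = - x k x j x i` for `i, j, k` distinct, `x i x j x k = x k x j x i` otherwise. -/
def twistedHalfCommRel : Set (NCPoly (Fin N)) :=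
  {P | ∃ i j k, (i ≠ j ∧ j ≠ k ∧ i ≠ k) ∧ P = X i * X j * X k + X k * X j * X i} ∪
  {P | ∃ i j k, ¬(i ≠ j ∧ j ≠ k ∧ i ≠ k) ∧ P = X i * X j * X k - X k * X j * X i}

end relations

theorem isBoundedRel_sphere {N : ℕ} (R : Set (NCPoly (Fin N))) :
    IsBoundedRel (sphereRel N ∪ R) :=
  isBoundedRel_of_sq _ fun i => ⟨Finset.univ, Finset.mem_univ i, Or.inl rfl⟩

/-- The subspace of the free real sphere obtained by imposing the relations `P = 0`, `P ∈ R`. -/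
def SphereSubspace.ofRel {N : ℕ} (R : Set (NCPoly (Fin N))) : SphereSubspace N where
  alg := UniversalCStar (sphereRel N ∪ R) (isBoundedRel_sphere R)
  x := UniversalCStar.gen _ _
  star_x := UniversalCStar.star_gen
  sum_sq := by
    have := UniversalCStar.relation (hR := isBoundedRel_sphere R)
      (P := ∑ i, X i * X i - 1) (Or.inl rfl)
    simpa [sub_eq_zero] using this
  generates := UniversalCStar.generates

/-- The polygonal sphere: points of the unit sphere of `ℝ^N` such that `x i₀ ⋯ x i_d = 0` for
`i₀, …, i_d` distinct. -/
def polygonalSphereSet (N d : ℕ) : Set (EuclideanSpace ℝ (Fin N)) :=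
  {x | ‖x‖ = 1 ∧ ∀ i : Fin (d + 1) → Fin N, Function.Injective i → ∏ k, x (i k) = 0}

instance (N d : ℕ) : CompactSpace (polygonalSphereSet N d) := by
  rw [← isCompact_iff_compactSpace]
  have hc : IsClosed (polygonalSphereSet N d) := by
    have h : polygonalSphereSet N d = {x | ‖x‖ = 1} ∩
        ⋂ i : Fin (d + 1) → Fin N, ⋂ _ : Function.Injective i,
          {x : EuclideanSpace ℝ (Fin N) | ∏ k, x (i k) = 0} := by
      ext x; simp [polygonalSphereSet]
    rw [h]
    refine (isClosed_eq continuous_norm continuous_const).inter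
      (isClosed_iInter fun i => isClosed_iInter fun _ => isClosed_eq ?_ continuous_const)
    fun_prop
  refine (isCompact_sphere (0 : EuclideanSpace ℝ (Fin N)) 1).of_isClosed_subset hc fun x hx => ?_
  simpa using hx.1

/-- The real polygonal sphere, with its algebra of continuous functions. -/
def polygonalSphere (N d : ℕ) : SphereSubspace N where
  alg := C(polygonalSphereSet N d, ℂ)
  x i := ⟨fun p => ((p.1 i : ℝ) : ℂ), by fun_prop⟩
  star_x i := by ext p; simp
  sum_sq := by
    ext p
    have h := p.2.1
    have h2 : ∑ i, p.1 i * p.1 i = 1 := by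
      have := EuclideanSpace.norm_sq_eq p.1
      rw [h] at this
      simpa [sq] using this.symm
    simp only [ContinuousMap.coe_sum, ContinuousMap.coe_mul, Finset.sum_apply, Pi.mul_apply,
      ContinuousMap.coe_mk, ContinuousMap.one_apply]
    exact_mod_cast h2
  generates := by
    apply ContinuousMap.starSubalgebra_topologicalClosure_eq_top_of_separatesPoints
    intro p q hpq
    obtain ⟨i, hi⟩ : ∃ i, p.1 i ≠ q.1 i := by
      by_contra! h
      exact hpq (Subtype.ext (PiLp.ext h))
    refine ⟨_, ⟨⟨fun p => ((p.1 i : ℝ) : ℂ), by fun_prop⟩,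
      StarAlgebra.subset_adjoin ℂ _ ⟨i, rfl⟩, rfl⟩, ?_⟩
    simpa using hi

/-- The twisted polygonal sphere. -/
def twistedPolygonalSphere (N d : ℕ) : SphereSubspace N :=
  .ofRel (anticommRel N ∪ polygonalRel N d)

/-- The half-liberated polygonal sphere. -/
def halfPolygonalSphere (N d : ℕ) : SphereSubspace N :=
  .ofRel (halfCommRel (Fin N) ∪ polygonalRel N d)

/-- The twisted half-liberated polygonal sphere. -/
def twistedHalfPolygonalSphere (N d : ℕ) : SphereSubspace N :=
  .ofRel (twistedHalfCommRel N ∪ polygonalRel N d)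

/-- The free polygonal sphere. -/
def freePolygonalSphere (N d : ℕ) : SphereSubspace N :=
  .ofRel (polygonalRel N d)

/-! ### Closed quantum subgroups of the free orthogonal quantum group -/

/-- A closed quantum subgroup `G` of the free orthogonal quantum group: a C*-algebra `C(G)`
generated by the self-adjoint entries of an orthogonal matrix `u`, such that
`u i j ↦ ∑ k, u i k ⊗ u k j` defines a comultiplication. -/
structure QuantumSubgroup (τ : TensorKind) (N : ℕ) where
  alg : Type
  [cstar : CStarAlgebra alg]
  u : Fin N → Fin N → alg
  star_u : ∀ i j, star (u i j) = u i j
  row_orth : ∀ i j, ∑ k, u i k * u j k = if i = j then 1 else 0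
  col_orth : ∀ i j, ∑ k, u k i * u k j = if i = j then 1 else 0
  generates : (StarAlgebra.adjoin ℂ
    (Set.range fun a : Fin N × Fin N => u a.1 a.2)).topologicalClosure = ⊤
  exists_comul : ∃ Δ : alg →⋆ₐ[ℂ] τ.tensor alg alg,
    ∀ i j, Δ (u i j) = ∑ k, τ.tmul (u i k) (u k j)

attribute [instance] QuantumSubgroup.cstar

section relations

variable (N : ℕ)

/-- The matrix of variables is orthogonal. -/
def orthogonalRel : Set (NCPoly (Fin N × Fin N)) :=
  {P | ∃ i j, P = ∑ k, X (i, k) * X (j, k) - if i = j then 1 else 0} ∪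
  {P | ∃ i j, P = ∑ k, X (k, i) * X (k, j) - if i = j then 1 else 0}

/-- Two distinct matrix positions on the same row or on the same column. -/
def SameLine {N : ℕ} (a b : Fin N × Fin N) : Prop := a ≠ b ∧ (a.1 = b.1 ∨ a.2 = b.2)

/-- `a b = 0` whenever `a ≠ b` are on the same row or column. -/
def cubicRel : Set (NCPoly (Fin N × Fin N)) :=
  {P | ∃ a b, SameLine a b ∧ P = X a * X b}

/-- `a b c = 0` whenever `a ≠ c` are on the same row or column. -/
def higherCubicRel : Set (NCPoly (Fin N × Fin N)) :=
  {P | ∃ a b c, SameLine a c ∧ P = X a * X b * X c}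

end relations

theorem isBoundedRel_orthogonal {N : ℕ} (R : Set (NCPoly (Fin N × Fin N))) :
    IsBoundedRel (orthogonalRel N ∪ R) := by
  refine isBoundedRel_of_sq _ fun a =>
    ⟨Finset.univ.map ⟨fun k => (a.1, k), fun k l h => by simpa using h⟩, ?_, ?_⟩
  · exact Finset.mem_map.2 ⟨a.2, Finset.mem_univ _, rfl⟩
  · refine Or.inl (Or.inl ⟨a.1, a.1, ?_⟩)
    rw [Finset.sum_map, if_pos rfl]; rfl

/-- The relations `R` between the entries of an orthogonal matrix are stable under products of
matrices with commuting entries. -/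
def IsMultiplicativeRel {N : ℕ} (R : Set (NCPoly (Fin N × Fin N))) : Prop :=
  ∀ (T : Type) [CStarAlgebra T] (v w y : Fin N × Fin N → T) (hv : ∀ a, star (v a) = v a)
    (hw : ∀ a, star (w a) = w a) (hy : ∀ a, star (y a) = y a),
    (∀ a b, v a * w b = w b * v a) → (∀ i j, y (i, j) = ∑ k, v (i, k) * w (k, j)) →
    (∀ P ∈ orthogonalRel N ∪ R, eval v hv P = 0) → (∀ P ∈ orthogonalRel N ∪ R, eval w hw P = 0) →
    ∀ P ∈ R, eval y hy P = 0

section tmul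

variable {A B : Type} [CStarAlgebra A] [CStarAlgebra B] (τ : TensorKind)

theorem TensorKind.tmul_mul (a a' : A) (b b' : B) :
    τ.tmul a b * τ.tmul a' b' = τ.tmul (a * a') (b * b') := by
  rw [tmul, tmul, tmul, ← map_mul, Algebra.TensorProduct.tmul_mul_tmul]

theorem TensorKind.star_tmul (a : A) (b : B) : star (τ.tmul a b) = τ.tmul (star a) (star b) := by
  rw [tmul, tmul, ← map_star, TensorProduct.star_tmul]

/-- `a ↦ a ⊗ 1`. -/
def TensorKind.inl : A →⋆ₐ[ℂ] τ.tensor A B :=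
  (τ.seminorm A B).of.comp
    { (Algebra.TensorProduct.includeLeft : A →ₐ[ℂ] A ⊗[ℂ] B) with
      map_star' := fun a => by simp }

/-- `b ↦ 1 ⊗ b`. -/
def TensorKind.inr : B →⋆ₐ[ℂ] τ.tensor A B :=
  (τ.seminorm A B).of.comp
    { (Algebra.TensorProduct.includeRight : B →ₐ[ℂ] A ⊗[ℂ] B) with
      map_star' := fun a => by simp }

theorem TensorKind.inl_apply (a : A) : τ.inl (B := B) a = τ.tmul a 1 := rfl
theorem TensorKind.inr_apply (b : B) : τ.inr (A := A) b = τ.tmul 1 b := rfl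

theorem TensorKind.inl_mul_inr (a : A) (b : B) : τ.inl a * τ.inr b = τ.tmul a b := by
  rw [inl_apply, inr_apply, tmul_mul, one_mul, mul_one]

theorem TensorKind.inr_mul_inl (a : A) (b : B) : τ.inr b * τ.inl a = τ.tmul a b := by
  rw [inl_apply, inr_apply, tmul_mul, one_mul, mul_one]

end tmul

theorem NCPoly.eval_comp {I : Type} {S T : Type*} [CStarAlgebra S] [CStarAlgebra T]
    (φ : S →⋆ₐ[ℂ] T) (y : I → S) (hy : ∀ i, star (y i) = y i)
    (hy' : ∀ i, star (φ (y i)) = φ (y i)) (P : NCPoly I) :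
    eval (fun i => φ (y i)) hy' P = φ (eval y hy P) := by
  have hf : P ∈ StarAlgebra.adjoin ℂ (Set.range (X : I → NCPoly I)) := by
    rw [adjoin_X]; trivial
  have hle : StarAlgebra.adjoin ℂ (Set.range (X : I → NCPoly I)) ≤
      StarAlgHom.equalizer (eval (fun i => φ (y i)) hy') (φ.comp (eval y hy)) := by
    rw [StarAlgebra.adjoin_le_iff]
    rintro _ ⟨i, rfl⟩
    change _ = φ (eval y hy (X i))
    rw [eval_X]
    exact eval_X _ hy' i
  exact hle hf

section stable

variable {N : ℕ}

theorem SameLine.split {i p j q : Fin N} (h : SameLine (i, p) (j, q)) (k l : Fin N) :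
    SameLine (i, k) (j, l) ∨ SameLine (k, p) (l, q) := by
  obtain ⟨h1, h2⟩ := h
  simp only [SameLine, ne_eq, Prod.mk.injEq, not_and] at *
  grind

theorem mul_expand {T : Type} [Ring T] {v w y : Fin N × Fin N → T}
    (hc : ∀ a b, v a * w b = w b * v a) (hy : ∀ i j, y (i, j) = ∑ k, v (i, k) * w (k, j))
    (i p j q : Fin N) :
    y (i, p) * y (j, q) =
      ∑ k, ∑ l, (v (i, k) * v (j, l)) * (w (k, p) * w (l, q)) := by
  rw [hy, hy, Finset.sum_mul_sum]
  refine Finset.sum_congr rfl fun k _ => Finset.sum_congr rfl fun l _ => ?_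
  rw [mul_assoc, ← mul_assoc (w (k, p)), ← hc, mul_assoc, ← mul_assoc, mul_assoc]

theorem mul_expand₃ {T : Type} [Ring T] {v w y : Fin N × Fin N → T}
    (hc : ∀ a b, v a * w b = w b * v a) (hy : ∀ i j, y (i, j) = ∑ k, v (i, k) * w (k, j))
    (i p m s j q : Fin N) :
    y (i, p) * y (m, s) * y (j, q) =
      ∑ k, ∑ r, ∑ l, (v (i, k) * v (m, r) * v (j, l)) * (w (k, p) * w (r, s) * w (l, q)) := by
  rw [mul_expand hc hy, hy, Finset.sum_mul]
  refine Finset.sum_congr rfl fun k _ => ?_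
  rw [Finset.sum_mul_sum]
  refine Finset.sum_congr rfl fun r _ => Finset.sum_congr rfl fun l _ => ?_
  have h : w (k, p) * w (r, s) * v (j, l) = v (j, l) * (w (k, p) * w (r, s)) := by
    rw [mul_assoc, ← hc, ← mul_assoc, ← hc, mul_assoc]
  rw [mul_assoc, ← mul_assoc (w (k, p) * w (r, s)), h, mul_assoc (v (j, l)), ← mul_assoc]

theorem cubic_mul {T : Type} [Ring T] {v w y : Fin N × Fin N → T}
    (hc : ∀ a b, v a * w b = w b * v a) (hy : ∀ i j, y (i, j) = ∑ k, v (i, k) * w (k, j))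
    (hv : ∀ a b, SameLine a b → v a * v b = 0) (hw : ∀ a b, SameLine a b → w a * w b = 0)
    (a b : Fin N × Fin N) (hab : SameLine a b) : y a * y b = 0 := by
  obtain ⟨i, p⟩ := a
  obtain ⟨j, q⟩ := b
  rw [mul_expand hc hy]
  refine Finset.sum_eq_zero fun k _ => Finset.sum_eq_zero fun l _ => ?_
  rcases hab.split k l with h | h
  · rw [hv _ _ h, zero_mul]
  · rw [hw _ _ h, mul_zero]

theorem isMultiplicativeRel_higherCubic : IsMultiplicativeRel (higherCubicRel N) := by
  rintro T _ v w y hv hw hy hc hyvw h1 h2 _ ⟨⟨i, p⟩, ⟨m, s⟩, ⟨j, q⟩, hab, rfl⟩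
  have h1' (a b c) (h : SameLine a c) : v a * v b * v c = 0 := by
    simpa using h1 _ (Or.inr ⟨a, b, c, h, rfl⟩)
  have h2' (a b c) (h : SameLine a c) : w a * w b * w c = 0 := by
    simpa using h2 _ (Or.inr ⟨a, b, c, h, rfl⟩)
  rw [map_mul, map_mul, eval_X, eval_X, eval_X, mul_expand₃ hc hyvw]
  refine Finset.sum_eq_zero fun k _ => Finset.sum_eq_zero fun r _ =>
    Finset.sum_eq_zero fun l _ => ?_
  rcases hab.split k l with h | h
  · rw [h1' _ _ _ h, zero_mul]
  · rw [h2' _ _ _ h, mul_zero]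

theorem isMultiplicativeRel_half_cubic :
    IsMultiplicativeRel (halfCommRel (Fin N × Fin N) ∪ cubicRel N) := by
  rintro T _ v w y hv hw hy hc hyvw h1 h2 _ (⟨⟨i, p⟩, ⟨m, s⟩, ⟨j, q⟩, rfl⟩ | ⟨a, b, hab, rfl⟩)
  · have h1' (a b c) : v a * v b * v c = v c * v b * v a := by
      simpa [sub_eq_zero] using h1 _ (Or.inr (Or.inl ⟨a, b, c, rfl⟩))
    have h2' (a b c) : w a * w b * w c = w c * w b * w a := by
      simpa [sub_eq_zero] using h2 _ (Or.inr (Or.inl ⟨a, b, c, rfl⟩))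
    simp only [map_sub, map_mul, eval_X]
    rw [mul_expand₃ hc hyvw, mul_expand₃ hc hyvw, sub_eq_zero]
    simp_rw [h1' (i, _), h2' (_, p)]
    rw [Finset.sum_comm]
    refine (Finset.sum_congr rfl fun r _ => Finset.sum_comm).trans ?_
    rw [Finset.sum_comm]
  · rw [map_mul, eval_X, eval_X]
    exact cubic_mul hc hyvw
      (fun a b h => by simpa using h1 _ (Or.inr (Or.inr ⟨a, b, h, rfl⟩)))
      (fun a b h => by simpa using h2 _ (Or.inr (Or.inr ⟨a, b, h, rfl⟩))) a b hab

theorem orthogonal_mul {T : Type} [CStarAlgebra T] {v w y : Fin N × Fin N → T}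
    (hv : ∀ a, star (v a) = v a) (hw : ∀ a, star (w a) = w a) (hy : ∀ a, star (y a) = y a)
    (hc : ∀ a b, v a * w b = w b * v a) (hyvw : ∀ i j, y (i, j) = ∑ k, v (i, k) * w (k, j))
    (h1 : ∀ P ∈ orthogonalRel N, eval v hv P = 0) (h2 : ∀ P ∈ orthogonalRel N, eval w hw P = 0) :
    ∀ P ∈ orthogonalRel N, eval y hy P = 0 := by
  have h (v : Fin N × Fin N → T) (hv : ∀ a, star (v a) = v a)
      (h1 : ∀ P ∈ orthogonalRel N, eval v hv P = 0) (i j : Fin N) :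
      (∑ k, v (i, k) * v (j, k) = if i = j then 1 else 0) ∧
        ∑ k, v (k, i) * v (k, j) = if i = j then 1 else 0 := by
    have ha := h1 _ (Or.inl ⟨i, j, rfl⟩)
    have hb := h1 _ (Or.inr ⟨i, j, rfl⟩)
    rw [map_sub, sub_eq_zero, apply_ite (eval _ _), map_one, map_zero] at ha hb
    exact ⟨by simpa using ha, by simpa using hb⟩
  rintro P (⟨i, j, rfl⟩ | ⟨i, j, rfl⟩)
  · rw [map_sub, sub_eq_zero, apply_ite (eval _ _), map_one, map_zero, map_sum]
    simp only [map_mul, eval_X]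
    simp_rw [mul_expand hc hyvw]
    rw [Finset.sum_comm]
    simp_rw [Finset.sum_comm (s := (Finset.univ : Finset (Fin N))) (t := Finset.univ)
      (f := fun p l => v (i, _) * v (j, l) * (w (_, p) * w (l, p)))]
    simp_rw [← Finset.mul_sum, (h w hw h2 _ _).1]
    simp [(h v hv h1 i j).1]
  · rw [map_sub, sub_eq_zero, apply_ite (eval _ _), map_one, map_zero, map_sum]
    simp only [map_mul, eval_X]
    simp_rw [mul_expand hc hyvw]
    rw [Finset.sum_comm]
    simp_rw [Finset.sum_comm (s := (Finset.univ : Finset (Fin N))) (t := Finset.univ)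
      (f := fun p l => v (p, _) * v (p, l) * (w (_, i) * w (l, j)))]
    simp_rw [← Finset.sum_mul, (h v hv h1 _ _).2]
    simp [(h w hw h2 i j).2]

end stable

/-- The quantum subgroup of the free orthogonal quantum group obtained by imposing the relations
`P = 0`, `P ∈ R`, on the standard coordinates. -/
def QuantumSubgroup.ofRel (τ : TensorKind) {N : ℕ} (R : Set (NCPoly (Fin N × Fin N)))
    (hR : IsMultiplicativeRel R) : QuantumSubgroup τ N where
  alg := UniversalCStar (orthogonalRel N ∪ R) (isBoundedRel_orthogonal R)
  u i j := UniversalCStar.gen _ _ (i, j)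
  star_u i j := UniversalCStar.star_gen (i, j)
  row_orth i j := by
    have := UniversalCStar.relation (hR := isBoundedRel_orthogonal R) (Or.inl (Or.inl ⟨i, j, rfl⟩))
    rw [map_sub, sub_eq_zero, apply_ite (eval _ _), map_one, map_zero] at this
    simpa using this
  col_orth i j := by
    have := UniversalCStar.relation (hR := isBoundedRel_orthogonal R) (Or.inl (Or.inr ⟨i, j, rfl⟩))
    rw [map_sub, sub_eq_zero, apply_ite (eval _ _), map_one, map_zero] at this
    simpa using this
  generates := UniversalCStar.generates
  exists_comul := by
    let A := UniversalCStar (orthogonalRel N ∪ R) (isBoundedRel_orthogonal R)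
    let u : Fin N × Fin N → A := UniversalCStar.gen _ _
    have hu (a) : star (u a) = u a := UniversalCStar.star_gen a
    let v (a : Fin N × Fin N) : τ.tensor A A := τ.inl (u a)
    let w (a : Fin N × Fin N) : τ.tensor A A := τ.inr (u a)
    let y (a : Fin N × Fin N) : τ.tensor A A := ∑ k, τ.tmul (u (a.1, k)) (u (k, a.2))
    have hv (a) : star (v a) = v a := by rw [← map_star, hu]
    have hw (a) : star (w a) = w a := by rw [← map_star, hu]
    have hy (a) : star (y a) = y a := by
      simp only [y, star_sum, TensorKind.star_tmul, hu]
    have hc (a b) : v a * w b = w b * v a := by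
      rw [TensorKind.inl_mul_inr, TensorKind.inr_mul_inl]
    have hyvw (i j) : y (i, j) = ∑ k, v (i, k) * w (k, j) := by
      simp only [y, v, w, TensorKind.inl_mul_inr]
    have h1 : ∀ P ∈ orthogonalRel N ∪ R, eval v hv P = 0 := fun P hP => by
      rw [eval_comp τ.inl u hu, UniversalCStar.relation hP, map_zero]
    have h2 : ∀ P ∈ orthogonalRel N ∪ R, eval w hw P = 0 := fun P hP => by
      rw [eval_comp τ.inr u hu, UniversalCStar.relation hP, map_zero]
    have h3 : ∀ P ∈ orthogonalRel N ∪ R, eval y hy P = 0 := by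
      rintro P (hP | hP)
      · exact orthogonal_mul hv hw hy hc hyvw (fun P hP => h1 P (Or.inl hP))
          (fun P hP => h2 P (Or.inl hP)) P hP
      · exact hR _ v w y hv hw hy hc hyvw h1 h2 P hP
    obtain ⟨Δ, hΔ⟩ := UniversalCStar.exists_lift (hR := isBoundedRel_orthogonal R) y hy h3
    exact ⟨Δ, fun i j => hΔ (i, j)⟩

/-- The half-liberated hyperoctahedral quantum group: `a b c = c b a` for all the coordinates, and
`a b = 0` whenever `a ≠ b` are on the same row or column. -/
def halfHyperoctahedral (τ : TensorKind) (N : ℕ) : QuantumSubgroup τ N :=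
  .ofRel τ (halfCommRel (Fin N × Fin N) ∪ cubicRel N) isMultiplicativeRel_half_cubic

/-- The higher hyperoctahedral quantum group: `a b c = 0` whenever `a ≠ c` are coordinates on the
same row or column, with `b` an arbitrary coordinate. -/
def higherHyperoctahedral (τ : TensorKind) (N : ℕ) : QuantumSubgroup τ N :=
  .ofRel τ (higherCubicRel N) isMultiplicativeRel_higherCubic

/-! ### The hyperoctahedral group -/

/-- The hyperoctahedral group, formed by the signed permutation matrices: `e_j ↦ ± e_{σ j}`. -/
def hyperoctahedralGroup (N : ℕ) : Submonoid (Matrix (Fin N) (Fin N) ℝ) where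
  carrier := {U | ∃ (σ : Equiv.Perm (Fin N)) (ε : Fin N → ℤˣ),
    U = Matrix.of fun i j => if i = σ j then ((ε i : ℤ) : ℝ) else 0}
  one_mem' := ⟨1, 1, by ext i j; simp [Matrix.one_apply]⟩
  mul_mem' := by
    rintro _ _ ⟨σ, ε, rfl⟩ ⟨σ', ε', rfl⟩
    refine ⟨σ * σ', fun i => ε i * ε' (σ⁻¹ i), ?_⟩
    ext i j
    simp only [Matrix.mul_apply, Matrix.of_apply]
    rw [Finset.sum_eq_single (σ' j)]
    · by_cases h : i = σ (σ' j)
      · subst h; simp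
      · simp [h]
    · intro k _ hk; simp [hk]
    · simp

instance (N : ℕ) : Finite (hyperoctahedralGroup N) := by
  have : (hyperoctahedralGroup N : Set (Matrix (Fin N) (Fin N) ℝ)) ⊆
      Set.range fun p : Equiv.Perm (Fin N) × (Fin N → ℤˣ) =>
        (Matrix.of fun i j => if i = p.1 j then ((p.2 i : ℤ) : ℝ) else 0 :
          Matrix (Fin N) (Fin N) ℝ) := by
    rintro _ ⟨σ, ε, rfl⟩; exact ⟨(σ, ε), rfl⟩
  exact (Set.finite_range _).subset this

theorem hyperoctahedralGroup.orthogonal {N : ℕ} (U : hyperoctahedralGroup N) :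
    U.1 * U.1.transpose = 1 ∧ U.1.transpose * U.1 = 1 := by
  have key : U.1 * U.1.transpose = 1 := by
    obtain ⟨_, σ, ε, rfl⟩ := U
    ext i j
    simp only [Matrix.mul_apply, Matrix.transpose_apply, Matrix.of_apply, Matrix.one_apply]
    rw [Finset.sum_eq_single (σ⁻¹ i)]
    · by_cases h : i = j
      · subst h
        simp [← Int.cast_mul, ← Units.val_mul]
      · simp [h, Ne.symm h]
    · intro k _ hk
      rw [if_neg, zero_mul]
      rintro rfl; simp at hk
    · simp
  exact ⟨key, mul_eq_one_comm.1 key⟩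

theorem exists_comul_finite (τ : TensorKind) (M : Type) [Monoid M] [TopologicalSpace M] [Finite M]
    [DiscreteTopology M] {κ : Type} [Fintype κ] :
    ∃ Δ : C(M, ℂ) →⋆ₐ[ℂ] τ.tensor C(M, ℂ) C(M, ℂ),
      ∀ (f : C(M, ℂ)) (a b : κ → C(M, ℂ)), (∀ g h, f (g * h) = ∑ k, a k g * b k h) →
        Δ f = ∑ k, τ.tmul (a k) (b k) := by
  classical
  cases nonempty_fintype M
  let e (g : M) : C(M, ℂ) := ⟨fun h => if h = g then 1 else 0, continuous_of_discreteTopology⟩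
  have he (g h : M) : e g * e h = if g = h then e g else 0 := by
    ext x; by_cases h1 : g = h <;> by_cases h2 : x = g <;> simp_all [e]
  have hse (g : M) : star (e g) = e g := by
    ext x; by_cases h2 : x = g <;> simp_all [e]
  have hsum (f : C(M, ℂ)) : f = ∑ g, f g • e g := by
    ext x; simp [e]
  have hone : ∑ g, e g = 1 := by ext x; simp [e]
  let E (p : M × M) : τ.tensor C(M, ℂ) C(M, ℂ) := τ.tmul (e p.1) (e p.2)
  have hE (p q : M × M) : E p * E q = if p = q then E p else 0 := by
    simp only [E, TensorKind.tmul_mul, he]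
    by_cases h1 : p.1 = q.1 <;> by_cases h2 : p.2 = q.2 <;>
      simp [h1, h2, Prod.ext_iff, ← TensorKind.inl_mul_inr]
  have hE1 : ∑ p, E p = 1 := by
    simp only [E, ← TensorKind.inl_mul_inr, Fintype.sum_prod_type]
    rw [← Finset.sum_mul_sum, ← map_sum, ← map_sum, hone, map_one, map_one, mul_one]
  let D : C(M, ℂ) →⋆ₐ[ℂ] τ.tensor C(M, ℂ) C(M, ℂ) :=
    { toFun := fun f => ∑ p, f (p.1 * p.2) • E p
      map_one' := by simpa using hE1
      map_zero' := by simp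
      map_add' := fun f f' => by simp [add_smul, Finset.sum_add_distrib]
      map_mul' := fun f f' => by
        rw [Finset.sum_mul_sum]
        simp [hE, smul_smul, mul_comm]
      commutes' := fun c => by
        simp [Algebra.algebraMap_eq_smul_one, ← Finset.smul_sum, hE1]
      map_star' := fun f => by
        simp only [star_sum, star_smul, E, TensorKind.star_tmul, hse]
        rfl }
  refine ⟨D, fun f a b hab => ?_⟩
  change ∑ p : M × M, f (p.1 * p.2) • E p = _
  have h (a b : C(M, ℂ)) : τ.tmul a b = ∑ p : M × M, (a p.1 * b p.2) • E p := by
    rw [← TensorKind.inl_mul_inr]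
    nth_rewrite 1 [hsum a, hsum b]
    simp only [map_sum, map_smul]
    rw [Finset.sum_mul_sum, Fintype.sum_prod_type]
    simp [E, TensorKind.inl_mul_inr, smul_smul, mul_comm]
  simp_rw [h, hab, Finset.sum_smul]
  exact Finset.sum_comm

theorem hyperoctahedralGroup.continuous_entry {N : ℕ} (i j : Fin N) :
    Continuous fun U : hyperoctahedralGroup N => ((U.1 i j : ℝ) : ℂ) :=
  continuous_of_discreteTopology

/-- The hyperoctahedral group as a quantum group, with its algebra of (continuous) functions. -/
def hyperoctahedral (τ : TensorKind) (N : ℕ) : QuantumSubgroup τ N where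
  alg := C(hyperoctahedralGroup N, ℂ)
  u i j := ⟨fun U => ((U.1 i j : ℝ) : ℂ), hyperoctahedralGroup.continuous_entry i j⟩
  star_u i j := by ext U; simp
  row_orth i j := by
    ext U
    have h := congrFun (congrFun (hyperoctahedralGroup.orthogonal U).1 i) j
    simp only [Matrix.mul_apply, Matrix.transpose_apply, Matrix.one_apply] at h
    have h' := congrArg (fun r : ℝ => (r : ℂ)) h
    rw [apply_ite (DFunLike.coe · U)]
    simpa [apply_ite (fun r : ℝ => (r : ℂ))] using h'
  col_orth i j := by
    ext U
    have h := congrFun (congrFun (hyperoctahedralGroup.orthogonal U).2 i) j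
    simp only [Matrix.mul_apply, Matrix.transpose_apply, Matrix.one_apply] at h
    have h' := congrArg (fun r : ℝ => (r : ℂ)) h
    rw [apply_ite (DFunLike.coe · U)]
    simpa [apply_ite (fun r : ℝ => (r : ℂ))] using h'
  generates := by
    apply ContinuousMap.starSubalgebra_topologicalClosure_eq_top_of_separatesPoints
    intro p q hpq
    obtain ⟨i, j, hi⟩ : ∃ i j, p.1 i j ≠ q.1 i j := by
      by_contra! h
      exact hpq (Subtype.ext (Matrix.ext h))
    refine ⟨_, ⟨⟨fun U => ((U.1 i j : ℝ) : ℂ), hyperoctahedralGroup.continuous_entry i j⟩,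
      StarAlgebra.subset_adjoin ℂ _ ⟨(i, j), rfl⟩, rfl⟩, ?_⟩
    simpa using hi
  exists_comul := by
    obtain ⟨Δ, hΔ⟩ := exists_comul_finite τ (hyperoctahedralGroup N) (κ := Fin N)
    refine ⟨Δ, fun i j => hΔ _ _ _ fun g h => ?_⟩
    simp [Matrix.mul_apply]

/-! ### Actions -/

/-- `G` acts affinely on `X`: there is a morphism of C*-algebras `C(X) → C(G) ⊗ C(X)` with
`x i ↦ ∑ j, u i j ⊗ x j`. -/
def QuantumSubgroup.ActsOn {τ : TensorKind} {N : ℕ} (G : QuantumSubgroup τ N)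
    (S : SphereSubspace N) : Prop :=
  ∃ Φ : S.alg →⋆ₐ[ℂ] τ.tensor G.alg S.alg, ∀ i, Φ (S.x i) = ∑ j, τ.tmul (G.u i j) (S.x j)

end

/-! The elements `X i = ∑ j, u i j ⊗ x j` are self-adjoint with `∑ i, X i ^ 2 = 1`, so the point is
that they satisfy the same relations as the coordinates `x i`. All the quantum groups involved are
contained in the higher hyperoctahedral one, where the squares of the entries are central and
`a b = 0` for `a ≠ b` on the same line; hence a word `u i₁ j₁ ⋯ u iₙ jₙ` vanishes unless `i` and `j`
have the same kernel, `i k = i l ↔ j k = j l`. Each relation equates the word `x i₁ ⋯ x iₙ` with a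
multiple of a permutation of it, with a coefficient depending only on the kernel of `i`, and
therefore passes to the `X i`. On the classical sphere the finite group `H_N` simply acts by
homeomorphisms. -/

open Equiv Function NCPoly

/-! ### Words -/

section words

/-- The word `y i₀ ⋯ y iₙ₋₁` in the family `y`, with letters indexed by the tuple `i`. -/
def word {I T : Type*} [Monoid T] (y : I → T) {n : ℕ} (i : Fin n → I) : T :=
  (List.ofFn fun k => y (i k)).prod

section monoid

variable {I T : Type*} [Monoid T] (y : I → T)

theorem word_zero (i : Fin 0 → I) : word y i = 1 := by
  simp [word]

theorem word_cons {n : ℕ} (a : I) (i : Fin n → I) :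
    word y (Fin.cons a i : Fin (n + 1) → I) = y a * word y i := by
  simp [word, List.ofFn_succ]

theorem word_two (i : Fin 2 → I) : word y i = y (i 0) * y (i 1) := by
  simp [word, List.ofFn_succ]

theorem word_three (i : Fin 3 → I) : word y i = y (i 0) * y (i 1) * y (i 2) := by
  simp [word, List.ofFn_succ, mul_assoc]

theorem word_comp_rev_two (i : Fin 2 → I) : word y (i ∘ Fin.revPerm) = y (i 1) * y (i 0) :=
  word_two y _

theorem word_comp_rev_three (i : Fin 3 → I) :
    word y (i ∘ Fin.revPerm) = y (i 2) * y (i 1) * y (i 0) :=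
  word_three y _

end monoid

theorem mul_mul_eq_zero_of_commute {T : Type*} [SemigroupWithZero T] {a x c : T}
    (ha : a * (a * a) = a) (hx : Commute (a * a) x) (hac : a * c = 0) : a * x * c = 0 :=
  calc a * x * c = a * (a * a * x) * c := by rw [← mul_assoc, ha]
    _ = a * x * a * (a * c) := by rw [hx.eq]; simp only [mul_assoc]
    _ = 0 := by rw [hac, mul_zero]

theorem pairwise_mul_ne_zero_of_prod_ne_zero {I T : Type*} [MonoidWithZero T] {y : I → T}
    (hcube : ∀ a, y a * (y a * y a) = y a) (hsq : ∀ a b, Commute (y a * y a) (y b)) {l : List I}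
    (hl : (l.map y).prod ≠ 0) : l.Pairwise fun a b => y a * y b ≠ 0 := by
  induction l with
  | nil => exact .nil
  | cons a l ih =>
    rw [List.map_cons, List.prod_cons] at hl
    refine List.pairwise_cons.2 ⟨fun c hc hac => hl ?_, ih (right_ne_zero_of_mul hl)⟩
    obtain ⟨s, t, rfl⟩ := List.append_of_mem hc
    have hs : Commute (y a * y a) (s.map y).prod :=
      Commute.list_prod_right _ _ fun x hx => by
        obtain ⟨b, -, rfl⟩ := List.mem_map.1 hx
        exact hsq a b
    rw [List.map_append, List.map_cons, List.prod_append, List.prod_cons, ← mul_assoc,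
      ← mul_assoc, mul_mul_eq_zero_of_commute (hcube a) hs hac, zero_mul]

end words

/-! ### Relations between self-adjoint elements -/

section relations

variable {I : Type*}

/-- The sign in the twisted half-commutation relations: `x i₀ x i₁ x i₂ = ± x i₂ x i₁ x i₀`. -/
def twistSign [DecidableEq I] (i : Fin 3 → I) : ℤ := if Injective i then -1 else 1

theorem injective_fin_three_iff (i : Fin 3 → I) :
    Injective i ↔ i 0 ≠ i 1 ∧ i 1 ≠ i 2 ∧ i 0 ≠ i 2 := by
  simp only [Injective, Fin.forall_fin_succ]
  grind

end relations

section satisfies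

variable {I : Type} {T : Type*} [Ring T] [StarRing T] [Algebra ℂ T] [StarModule ℂ T]

/-- The self-adjoint elements `y i` satisfy the relations `P = 0`, for `P ∈ R`. -/
def Satisfies (y : I → T) (hy : ∀ i, star (y i) = y i) (R : Set (NCPoly I)) : Prop :=
  ∀ P ∈ R, eval y hy P = 0

variable {y : I → T} {hy : ∀ i, star (y i) = y i}

theorem satisfies_union {R R' : Set (NCPoly I)} :
    Satisfies y hy (R ∪ R') ↔ Satisfies y hy R ∧ Satisfies y hy R' := by
  simp only [Satisfies, Set.mem_union, or_imp, forall_and]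

theorem satisfies_halfCommRel_iff :
    Satisfies y hy (halfCommRel I) ↔
      ∀ i : Fin 3 → I, word y i = word y (i ∘ Fin.revPerm) := by
  simp only [word_comp_rev_three]
  simp only [word_three y]
  constructor
  · intro h i
    simpa [sub_eq_zero] using h _ ⟨i 0, i 1, i 2, rfl⟩
  · rintro h _ ⟨a, b, c, rfl⟩
    simpa [sub_eq_zero] using h ![a, b, c]

end satisfies

section satisfiesFin

variable {N : ℕ} {T : Type*} [Ring T] [StarRing T] [Algebra ℂ T] [StarModule ℂ T]

theorem satisfies_sphereRel_iff {y : Fin N → T} {hy : ∀ i, star (y i) = y i} :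
    Satisfies y hy (sphereRel N) ↔ ∑ i, y i * y i = 1 := by
  simp [Satisfies, sphereRel, sub_eq_zero]

theorem satisfies_polygonalRel_iff {d : ℕ} {y : Fin N → T} {hy : ∀ i, star (y i) = y i} :
    Satisfies y hy (polygonalRel N d) ↔
      ∀ i : Fin (d + 1) → Fin N, Injective i → word y i = 0 := by
  have heval (i : Fin (d + 1) → Fin N) :
      eval y hy (List.ofFn fun k => X (i k)).prod = word y i := by
    simp [word, map_list_prod, List.map_ofFn, comp_def]
  constructor
  · intro h i hi
    rw [← heval, h _ ⟨i, hi, rfl⟩]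
  · rintro h _ ⟨i, hi, rfl⟩
    rw [heval, h i hi]

theorem satisfies_anticommRel_iff {y : Fin N → T} {hy : ∀ i, star (y i) = y i} :
    Satisfies y hy (anticommRel N) ↔
      ∀ i : Fin 2 → Fin N, Injective i → word y i = (-1 : ℤ) • word y (i ∘ Fin.revPerm) := by
  simp only [word_comp_rev_two, neg_smul, one_smul]
  simp only [word_two y]
  constructor
  · intro h i hi
    simpa [eq_neg_iff_add_eq_zero] using h _ ⟨i 0, i 1, hi.ne zero_ne_one, rfl⟩
  · rintro h _ ⟨i, j, hij, rfl⟩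
    have hinj : Injective ![i, j] := by simp [Injective, Fin.forall_fin_succ, hij, hij.symm]
    simpa [eq_neg_iff_add_eq_zero] using h ![i, j] hinj

theorem satisfies_twistedHalfCommRel_iff {y : Fin N → T} {hy : ∀ i, star (y i) = y i} :
    Satisfies y hy (twistedHalfCommRel N) ↔
      ∀ i : Fin 3 → Fin N, word y i = twistSign i • word y (i ∘ Fin.revPerm) := by
  simp only [word_comp_rev_three, twistSign, injective_fin_three_iff]
  simp only [word_three y]
  constructor
  · intro h i
    split_ifs with hi
    · simpa [eq_neg_iff_add_eq_zero] using h _ (Or.inl ⟨i 0, i 1, i 2, hi, rfl⟩)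
    · simpa [sub_eq_zero] using h _ (Or.inr ⟨i 0, i 1, i 2, hi, rfl⟩)
  · rintro h _ (⟨i, j, k, hijk, rfl⟩ | ⟨i, j, k, hijk, rfl⟩) <;>
      have hword : y i * y j * y k = (if i ≠ j ∧ j ≠ k ∧ i ≠ k then -1 else 1 : ℤ) •
        (y k * y j * y i) := h ![i, j, k]
    · rw [if_pos hijk] at hword
      simpa [eq_neg_iff_add_eq_zero] using hword
    · rw [if_neg hijk] at hword
      simpa [sub_eq_zero] using hword

theorem satisfies_cubicRel_iff {y : Fin N × Fin N → T} {hy : ∀ a, star (y a) = y a} :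
    Satisfies y hy (cubicRel N) ↔ ∀ a b, SameLine a b → y a * y b = 0 := by
  constructor
  · intro h a b hab
    simpa using h _ ⟨a, b, hab, rfl⟩
  · rintro h _ ⟨a, b, hab, rfl⟩
    simpa using h a b hab

theorem satisfies_higherCubicRel_iff {y : Fin N × Fin N → T} {hy : ∀ a, star (y a) = y a} :
    Satisfies y hy (higherCubicRel N) ↔ ∀ a b c, SameLine a c → y a * y b * y c = 0 := by
  constructor
  · intro h a b c hac
    simpa using h _ ⟨a, b, c, hac, rfl⟩
  · rintro h _ ⟨a, b, c, hac, rfl⟩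
    simpa using h a b c hac

end satisfiesFin

theorem SphereSubspace.satisfies_ofRel {N : ℕ} (R : Set (NCPoly (Fin N))) :
    Satisfies (SphereSubspace.ofRel R).x (SphereSubspace.ofRel R).star_x R :=
  fun _ hP => UniversalCStar.relation (hR := isBoundedRel_sphere R) (Or.inr hP)

/-! ### Tensor products -/

namespace TensorKind

variable {A B : Type} [CStarAlgebra A] [CStarAlgebra B] (τ : TensorKind)

theorem zero_tmul (b : B) : τ.tmul (0 : A) b = 0 := by
  rw [← inl_mul_inr, map_zero, zero_mul]

theorem tmul_one_one : τ.tmul (1 : A) (1 : B) = 1 := by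
  rw [← inl_mul_inr, map_one, map_one, mul_one]

theorem sum_tmul {ι : Type*} (s : Finset ι) (a : ι → A) (b : B) :
    τ.tmul (∑ i ∈ s, a i) b = ∑ i ∈ s, τ.tmul (a i) b := by
  simp only [← inl_mul_inr, map_sum, Finset.sum_mul]

theorem tmul_sum {ι : Type*} (s : Finset ι) (a : A) (b : ι → B) :
    τ.tmul a (∑ i ∈ s, b i) = ∑ i ∈ s, τ.tmul a (b i) := by
  simp only [← inl_mul_inr, map_sum, Finset.mul_sum]

theorem tmul_zsmul (a : A) (c : ℤ) (b : B) : τ.tmul a (c • b) = c • τ.tmul a b := by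
  simp only [← inl_mul_inr, map_zsmul, mul_smul_comm]

theorem tmul_smul (a : A) (c : ℂ) (b : B) : τ.tmul a (c • b) = τ.tmul (c • a) b := by
  simp only [← inl_mul_inr, map_smul, mul_smul_comm, smul_mul_assoc]

end TensorKind

/-! ### The coaction on the coordinates -/

namespace QuantumSubgroup

variable {τ : TensorKind} {N : ℕ} (G : QuantumSubgroup τ N)

/-- The standard coordinates `u i j`, indexed by the positions `(i, j)` as in the relations defining
the quantum groups. -/
def coord (a : Fin N × Fin N) : G.alg := G.u a.1 a.2

theorem star_coord (a : Fin N × Fin N) : star (G.coord a) = G.coord a := G.star_u a.1 a.2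

theorem satisfies_ofRel {R : Set (NCPoly (Fin N × Fin N))} (hR : IsMultiplicativeRel R) :
    Satisfies (ofRel τ R hR).coord (ofRel τ R hR).star_coord R :=
  fun _ hP => UniversalCStar.relation (hR := isBoundedRel_orthogonal R) (Or.inr hP)

/-- The element `∑ j, u i j ⊗ x j`, which has to be the image of `x i` under an action of `G`. -/
noncomputable def coact (S : SphereSubspace N) (i : Fin N) : τ.tensor G.alg S.alg :=
  ∑ j, τ.tmul (G.u i j) (S.x j)

variable (S : SphereSubspace N)

theorem star_coact (i : Fin N) : star (G.coact S i) = G.coact S i := by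
  simp only [coact, star_sum, TensorKind.star_tmul, G.star_u, S.star_x]

theorem sum_coact_mul_coact : ∑ i, G.coact S i * G.coact S i = 1 :=
  calc ∑ i, G.coact S i * G.coact S i
      = ∑ i, ∑ p, ∑ q, τ.tmul (G.u i p * G.u i q) (S.x p * S.x q) := by
        simp only [coact, Finset.sum_mul_sum, TensorKind.tmul_mul]
    _ = ∑ p, ∑ q, ∑ i, τ.tmul (G.u i p * G.u i q) (S.x p * S.x q) := by
        rw [Finset.sum_comm]
        exact Finset.sum_congr rfl fun p _ => Finset.sum_comm
    _ = ∑ p, ∑ q, if p = q then τ.tmul 1 (S.x p * S.x q) else 0 := by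
        refine Finset.sum_congr rfl fun p _ => Finset.sum_congr rfl fun q _ => ?_
        rw [← TensorKind.sum_tmul, G.col_orth]
        split_ifs <;> simp only [TensorKind.zero_tmul]
    _ = τ.tmul 1 (∑ p, S.x p * S.x p) := by
        simp only [Finset.sum_ite_eq, Finset.mem_univ, if_true, TensorKind.tmul_sum]
    _ = 1 := by rw [S.sum_sq, TensorKind.tmul_one_one]

theorem actsOn_ofRel {R : Set (NCPoly (Fin N))}
    (h : Satisfies (G.coact (.ofRel R)) (G.star_coact _) R) : G.ActsOn (.ofRel R) :=
  UniversalCStar.exists_lift (hR := isBoundedRel_sphere R) _ _ <| satisfies_union.2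
    ⟨satisfies_sphereRel_iff.2 (G.sum_coact_mul_coact _), h⟩

theorem word_coact {n : ℕ} (i : Fin n → Fin N) :
    word (G.coact S) i =
      ∑ j : Fin n → Fin N, τ.tmul (word G.coord fun k => (i k, j k)) (word S.x j) := by
  induction n with
  | zero => simp [word_zero, TensorKind.tmul_one_one]
  | succ n ih =>
    have hcons (p : Fin N) (j : Fin n → Fin N) :
        (fun k => (i k, (Fin.cons p j : Fin (n + 1) → Fin N) k)) =
          Fin.cons (i 0, p) fun k => (Fin.tail i k, j k) := by
      ext k : 1
      cases k using Fin.cases <;> rfl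
    calc word (G.coact S) i
        = G.coact S (i 0) * word (G.coact S) (Fin.tail i) := by
          rw [← word_cons, Fin.cons_self_tail]
      _ = ∑ p, ∑ j : Fin n → Fin N, τ.tmul (word G.coord fun k => (i k, Fin.cons p j k))
            (word S.x (Fin.cons p j : Fin (n + 1) → Fin N)) := by
          simp only [ih, coact, Finset.sum_mul_sum, TensorKind.tmul_mul, hcons, word_cons, coord]
      _ = _ := by
          rw [← (Fin.consEquiv fun _ => Fin N).sum_comp, Fintype.sum_prod_type]
          rfl

/-! ### Quantum subgroups of the higher hyperoctahedral quantum group -/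

section row

variable {G}

theorem mul_coord_mul_coord_of_mul_eq_zero {z : G.alg} {i p : Fin N}
    (hz : ∀ q ≠ p, z * G.coord (i, q) = 0) : z * (G.coord (i, p) * G.coord (i, p)) = z :=
  calc z * (G.coord (i, p) * G.coord (i, p))
      = ∑ q, z * (G.coord (i, q) * G.coord (i, q)) := by
        rw [Finset.sum_eq_single p (fun q _ hq => by rw [← mul_assoc, hz q hq, zero_mul])
          (by simp)]
    _ = z * ∑ q, G.u i q * G.u i q := (Finset.mul_sum _ _ _).symm
    _ = z := by rw [G.row_orth, if_pos rfl, mul_one]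

theorem coord_mul_coord_mul_of_mul_eq_zero {z : G.alg} {i p : Fin N}
    (hz : ∀ q ≠ p, G.coord (i, q) * z = 0) : G.coord (i, p) * G.coord (i, p) * z = z := by
  have h := mul_coord_mul_coord_of_mul_eq_zero (z := star z) (i := i) (p := p) fun q hq => by
    rw [← G.star_coord, ← star_mul, hz q hq, star_zero]
  simpa only [star_mul, star_star, star_coord] using congrArg star h

theorem coord_mul_coord_mul_coord_self (hG : ∀ a b, SameLine a b → G.coord a * G.coord b = 0)
    (a : Fin N × Fin N) : G.coord a * (G.coord a * G.coord a) = G.coord a :=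
  mul_coord_mul_coord_of_mul_eq_zero fun _ hq => hG _ _ ⟨fun h => hq (by rw [h]), Or.inl rfl⟩

end row

/-- `G` is a quantum subgroup of the higher hyperoctahedral quantum group: `a b c = 0` whenever
`a ≠ c` are coordinates on the same row or column. -/
def IsHigherCubic : Prop :=
  ∀ a b c, SameLine a c → G.coord a * G.coord b * G.coord c = 0

variable {G}

theorem isHigherCubic_of_commute_sq (hG : ∀ a b, SameLine a b → G.coord a * G.coord b = 0)
    (hsq : ∀ a b, Commute (G.coord a * G.coord a) (G.coord b)) : G.IsHigherCubic :=
  fun a b c hac =>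
    mul_mul_eq_zero_of_commute (coord_mul_coord_mul_coord_self hG a) (hsq a b) (hG a c hac)

namespace IsHigherCubic

theorem coord_mul_coord_eq_zero (h : G.IsHigherCubic) (a b : Fin N × Fin N) (hab : SameLine a b) :
    G.coord a * G.coord b = 0 := by
  rw [← CStarRing.mul_star_self_eq_zero_iff, star_mul, star_coord, star_coord, ← mul_assoc,
    h a b b hab, zero_mul]

theorem commute_sq (h : G.IsHigherCubic) (a b : Fin N × Fin N) :
    Commute (G.coord a * G.coord a) (G.coord b) := by
  obtain ⟨i, p⟩ := a
  set a := G.coord (i, p)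
  set b := G.coord b
  have hab : a * b * (a * a) = a * b :=
    mul_coord_mul_coord_of_mul_eq_zero fun q hq => h _ _ _ ⟨by simp [hq.symm], Or.inl rfl⟩
  have hba : a * a * (b * a) = b * a :=
    coord_mul_coord_mul_of_mul_eq_zero fun q hq => by
      rw [← mul_assoc]
      exact h _ _ _ ⟨by simp [hq], Or.inl rfl⟩
  calc a * a * b = a * (a * b * (a * a)) := by rw [hab, mul_assoc]
    _ = a * a * (b * a) * a := by simp only [mul_assoc]
    _ = b * (a * a) := by rw [hba, mul_assoc]

theorem eq_iff_eq_of_word_ne_zero (h : G.IsHigherCubic) {n : ℕ} {i j : Fin n → Fin N}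
    (hij : word G.coord (fun k => (i k, j k)) ≠ 0) (k l : Fin n) : i k = i l ↔ j k = j l := by
  have hpair : (List.ofFn fun k => (i k, j k)).Pairwise fun a b => G.coord a * G.coord b ≠ 0 := by
    refine pairwise_mul_ne_zero_of_prod_ne_zero
      (coord_mul_coord_mul_coord_self h.coord_mul_coord_eq_zero) h.commute_sq ?_
    rwa [List.map_ofFn]
  have hlt {k l : Fin n} (hkl : k < l) : i k = i l ↔ j k = j l := by
    have hne : ¬SameLine (i k, j k) (i l, j l) := fun hline =>
      List.pairwise_ofFn.1 hpair hkl (h.coord_mul_coord_eq_zero _ _ hline)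
    simp only [SameLine, ne_eq, Prod.mk.injEq] at hne
    tauto
  rcases lt_trichotomy k l with hkl | rfl | hkl
  · exact hlt hkl
  · simp only
  · rw [eq_comm, hlt hkl, eq_comm]

variable {S}

theorem word_coact_eq_smul (h : G.IsHigherCubic) {n : ℕ} {σ : Perm (Fin n)}
    (hσ : ∀ a : Fin n → Fin N × Fin N, word G.coord a = word G.coord (a ∘ σ)) {c : ℤ}
    {i : Fin n → Fin N}
    (hS : ∀ j : Fin n → Fin N, (∀ k l, i k = i l ↔ j k = j l) →
      word S.x j = c • word S.x (j ∘ σ)) :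
    word (G.coact S) i = c • word (G.coact S) (i ∘ σ) := by
  have hterm (j : Fin n → Fin N) :
      τ.tmul (word G.coord fun k => (i k, j k)) (word S.x j) =
        c • τ.tmul (word G.coord fun k => ((i ∘ σ) k, (j ∘ σ) k)) (word S.x (j ∘ σ)) := by
    rw [show (fun k => ((i ∘ σ) k, (j ∘ σ) k)) = (fun k => (i k, j k)) ∘ σ from rfl, ← hσ]
    by_cases hij : word G.coord (fun k => (i k, j k)) = 0
    · rw [hij, TensorKind.zero_tmul, TensorKind.zero_tmul, smul_zero]
    · rw [hS j (h.eq_iff_eq_of_word_ne_zero hij), TensorKind.tmul_zsmul]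
  rw [word_coact, word_coact, Finset.smul_sum]
  exact (Finset.sum_congr rfl fun j _ => hterm j).trans <|
    (σ.symm.arrowCongr (Equiv.refl (Fin N))).sum_comp fun j =>
      c • τ.tmul (word G.coord fun k => ((i ∘ σ) k, j k)) (word S.x j)

theorem injective_congr {n : ℕ} {i j : Fin n → Fin N} (h : ∀ k l, i k = i l ↔ j k = j l) :
    Injective i ↔ Injective j :=
  forall₂_congr fun k l => imp_congr_left (h k l)

theorem satisfies_coact_polygonalRel (h : G.IsHigherCubic) {d : ℕ}
    (hS : Satisfies S.x S.star_x (polygonalRel N d)) :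
    Satisfies (G.coact S) (G.star_coact S) (polygonalRel N d) := by
  rw [satisfies_polygonalRel_iff] at hS ⊢
  intro i hi
  simpa only [zero_smul] using h.word_coact_eq_smul (σ := 1) (c := 0) (i := i) (fun _ => rfl)
    fun j hij => by rw [hS j ((injective_congr hij).1 hi), zero_smul]

theorem satisfies_coact_anticommRel (h : G.IsHigherCubic)
    (hG : ∀ a b, Commute (G.coord a) (G.coord b))
    (hS : Satisfies S.x S.star_x (anticommRel N)) :
    Satisfies (G.coact S) (G.star_coact S) (anticommRel N) := by
  rw [satisfies_anticommRel_iff] at hS ⊢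
  intro i hi
  refine h.word_coact_eq_smul (fun a => ?_) fun j hij => hS j ((injective_congr hij).1 hi)
  rw [word_two, word_comp_rev_two, (hG _ _).eq]

theorem satisfies_coact_halfCommRel (h : G.IsHigherCubic)
    (hG : Satisfies G.coord G.star_coord (halfCommRel (Fin N × Fin N)))
    (hS : Satisfies S.x S.star_x (halfCommRel (Fin N))) :
    Satisfies (G.coact S) (G.star_coact S) (halfCommRel (Fin N)) := by
  rw [satisfies_halfCommRel_iff] at hG hS ⊢
  intro i
  simpa only [one_smul] using h.word_coact_eq_smul (c := 1) (i := i) hG fun j _ => by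
    rw [one_smul, ← hS j]

theorem satisfies_coact_twistedHalfCommRel (h : G.IsHigherCubic)
    (hG : Satisfies G.coord G.star_coord (halfCommRel (Fin N × Fin N)))
    (hS : Satisfies S.x S.star_x (twistedHalfCommRel N)) :
    Satisfies (G.coact S) (G.star_coact S) (twistedHalfCommRel N) := by
  rw [satisfies_halfCommRel_iff] at hG
  rw [satisfies_twistedHalfCommRel_iff] at hS ⊢
  intro i
  refine h.word_coact_eq_smul hG fun j hij => ?_
  have hsign : twistSign i = twistSign j := by simp only [twistSign, injective_congr hij]
  rw [hsign, ← hS j]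

end IsHigherCubic

end QuantumSubgroup

/-! ### The three hyperoctahedral quantum groups -/

section hyperoctahedral

variable (τ : TensorKind) (N : ℕ)

theorem hyperoctahedralGroup.mul_eq_zero_of_sameLine {N : ℕ} (U : hyperoctahedralGroup N)
    {a b : Fin N × Fin N} (hab : SameLine a b) : U.1 a.1 a.2 * U.1 b.1 b.2 = 0 := by
  obtain ⟨_, σ, ε, rfl⟩ := U
  have hne : ¬(a.1 = σ a.2 ∧ b.1 = σ b.2) := by
    rintro ⟨ha, hb⟩
    have h2 : a.2 = b.2 := hab.2.elim (fun h1 => σ.injective (by rw [← ha, h1, hb])) id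
    exact hab.1 (Prod.ext (by rw [ha, hb, h2]) h2)
  rw [not_and_or] at hne
  rcases hne with h | h <;> simp [h]

theorem hyperoctahedral_commute (a b : Fin N × Fin N) :
    Commute ((hyperoctahedral τ N).coord a) ((hyperoctahedral τ N).coord b) :=
  mul_comm (G := C(hyperoctahedralGroup N, ℂ)) _ _

theorem hyperoctahedral_isHigherCubic : (hyperoctahedral τ N).IsHigherCubic :=
  QuantumSubgroup.isHigherCubic_of_commute_sq
    (fun a b hab => ContinuousMap.ext (Y := ℂ) fun U => by
      change ((U.1 a.1 a.2 : ℝ) : ℂ) * ((U.1 b.1 b.2 : ℝ) : ℂ) = 0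
      rw [← Complex.ofReal_mul, hyperoctahedralGroup.mul_eq_zero_of_sameLine U hab,
        Complex.ofReal_zero])
    fun a b => (hyperoctahedral_commute τ N a b).mul_left (hyperoctahedral_commute τ N a b)

theorem halfHyperoctahedral_satisfies :
    Satisfies (halfHyperoctahedral τ N).coord (halfHyperoctahedral τ N).star_coord
      (halfCommRel (Fin N × Fin N) ∪ cubicRel N) :=
  QuantumSubgroup.satisfies_ofRel isMultiplicativeRel_half_cubic

theorem halfHyperoctahedral_isHigherCubic : (halfHyperoctahedral τ N).IsHigherCubic := by
  obtain ⟨hhalf, hcubic⟩ := satisfies_union.1 (halfHyperoctahedral_satisfies τ N)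
  rw [satisfies_halfCommRel_iff] at hhalf
  refine QuantumSubgroup.isHigherCubic_of_commute_sq (satisfies_cubicRel_iff.1 hcubic)
    fun a b => ?_
  have h := hhalf ![a, a, b]
  rw [word_three, word_comp_rev_three] at h
  exact h.trans (mul_assoc _ _ _)

theorem higherHyperoctahedral_isHigherCubic : (higherHyperoctahedral τ N).IsHigherCubic := by
  have h : Satisfies (higherHyperoctahedral τ N).coord (higherHyperoctahedral τ N).star_coord
      (higherCubicRel N) :=
    QuantumSubgroup.satisfies_ofRel isMultiplicativeRel_higherCubic
  exact satisfies_higherCubicRel_iff.1 h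

end hyperoctahedral

/-! ### Morphisms to `C(M) ⊗ B` for a finite space `M` -/

/-- Morphisms are glued along projections: `s ↦ ∑ g, p g * φ g s` is a *-homomorphism if the `p g`
are orthogonal projections with sum `1`, each commuting with the range of `φ g`. -/
def sumProjMul {S T ι : Type*} [Ring S] [StarRing S] [Algebra ℂ S] [Ring T] [StarRing T]
    [Algebra ℂ T] [Fintype ι] {p : ι → T} (hp : CompleteOrthogonalIdempotents p)
    (hstar : ∀ g, IsSelfAdjoint (p g)) (φ : ι → S →⋆ₐ[ℂ] T)
    (hφ : ∀ g s, Commute (p g) (φ g s)) : S →⋆ₐ[ℂ] T where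
  toFun s := ∑ g, p g * φ g s
  map_one' := by simp only [map_one, mul_one, hp.complete]
  map_zero' := by simp only [map_zero, mul_zero, Finset.sum_const_zero]
  map_add' s t := by simp only [map_add, mul_add, Finset.sum_add_distrib]
  map_mul' s t := by
    classical
    have hterm (g h : ι) : p g * φ g s * (p h * φ h t) =
        if g = h then p g * φ g (s * t) else 0 :=
      calc p g * φ g s * (p h * φ h t) = φ g s * (p g * p h) * φ h t := by
            rw [(hφ g s).eq]
            simp only [mul_assoc]
        _ = if g = h then p g * φ g (s * t) else 0 := by
            rw [hp.mul_eq]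
            split_ifs with hgh
            · rw [← hgh, ← (hφ g s).eq, map_mul, mul_assoc]
            · rw [mul_zero, zero_mul]
    simp only [Finset.sum_mul_sum, hterm, Finset.sum_ite_eq, Finset.mem_univ, if_true]
  commutes' c := by
    simp only [AlgHomClass.commutes, ← Finset.sum_mul, hp.complete, one_mul]
  map_star' s := by
    simp only [star_sum, star_mul, (hstar _).star_eq, ← map_star, (hφ _ _).eq]

section pointIndicator

variable {M : Type*} [TopologicalSpace M] [DiscreteTopology M] [DecidableEq M] (R : Type*)
  [TopologicalSpace R] [Semiring R]

/-- The indicator function of the point `g` of a discrete space. -/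
def pointIndicator (g : M) : C(M, R) :=
  ⟨Pi.single g 1, continuous_of_discreteTopology⟩

theorem completeOrthogonalIdempotents_pointIndicator [IsTopologicalSemiring R] [Fintype M] :
    CompleteOrthogonalIdempotents (pointIndicator R : M → C(M, R)) :=
  (CompleteOrthogonalIdempotents.map_injective_iff (ContinuousMap.coeFnRingHom (α := M) (β := R))
    DFunLike.coe_injective).1 (.single fun _ : M => R)

theorem sum_smul_pointIndicator [IsTopologicalSemiring R] [Fintype M] (f : C(M, R)) :
    ∑ g, f g • pointIndicator R g = f := by
  ext x
  simp [pointIndicator, Pi.single_apply]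

theorem isSelfAdjoint_pointIndicator [StarRing R] [ContinuousStar R] (g : M) :
    IsSelfAdjoint (pointIndicator R g) :=
  ContinuousMap.ext fun x => by
    simp [pointIndicator, Pi.single_apply, apply_ite star]

end pointIndicator

/-- If `φ` comes from an action of a finite group `M` on `A = B`, then `Φ` is the corresponding
coaction. -/
theorem exists_starAlgHom_tensor_continuousMap (τ : TensorKind) {M B : Type} {A : Type*}
    [TopologicalSpace M] [DiscreteTopology M] [Finite M] [CStarAlgebra B] [Ring A] [StarRing A]
    [Algebra ℂ A] (φ : M → A →⋆ₐ[ℂ] B) :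
    ∃ Φ : A →⋆ₐ[ℂ] τ.tensor C(M, ℂ) B, ∀ {κ : Type} [Fintype κ] (s : A) (f : κ → C(M, ℂ))
      (b : κ → B), (∀ g, φ g s = ∑ k, f k g • b k) → Φ s = ∑ k, τ.tmul (f k) (b k) := by
  classical
  cases nonempty_fintype M
  let p (g : M) : τ.tensor C(M, ℂ) B := τ.inl (pointIndicator ℂ g)
  have hp : CompleteOrthogonalIdempotents p :=
    (completeOrthogonalIdempotents_pointIndicator ℂ).map (τ.inl : C(M, ℂ) →⋆ₐ[ℂ] _).toRingHom
  have hcomm (g : M) (s : A) : Commute (p g) (τ.inr.comp (φ g) s) :=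
    (τ.inl_mul_inr _ _).trans (τ.inr_mul_inl _ _).symm
  refine ⟨sumProjMul hp (fun g => (isSelfAdjoint_pointIndicator ℂ g).map τ.inl)
    (fun g => τ.inr.comp (φ g)) hcomm, fun {κ} _ s f b hφ => ?_⟩
  calc ∑ g, τ.inl (pointIndicator ℂ g) * τ.inr (φ g s)
      = ∑ g, ∑ k, τ.tmul (f k g • pointIndicator ℂ g) (b k) := by
        simp only [τ.inl_mul_inr, hφ, τ.tmul_sum, τ.tmul_smul]
    _ = ∑ k, τ.tmul (∑ g, f k g • pointIndicator ℂ g) (b k) := by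
        simp only [τ.sum_tmul]
        exact Finset.sum_comm
    _ = ∑ k, τ.tmul (f k) (b k) := by simp only [sum_smul_pointIndicator]

/-! ### The action on the classical sphere -/

namespace hyperoctahedralGroup

variable {N d : ℕ} (U : hyperoctahedralGroup N)

theorem exists_mulVec_eq : ∃ (σ : Perm (Fin N)) (ε : Fin N → ℤˣ), ∀ (x : Fin N → ℝ) i,
    U.1.mulVec x i = ((ε i : ℤ) : ℝ) * x (σ i) := by
  obtain ⟨σ, ε, hU⟩ := U.2
  refine ⟨σ.symm, ε, fun x i => ?_⟩
  rw [hU, Matrix.mulVec, dotProduct, Finset.sum_eq_single (σ.symm i)]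
  · simp
  · intro k _ hk
    rw [Matrix.of_apply, if_neg fun h => hk (σ.eq_symm_apply.2 h.symm), zero_mul]
  · simp

theorem mulVec_mem_polygonalSphereSet {x : EuclideanSpace ℝ (Fin N)}
    (hx : x ∈ polygonalSphereSet N d) :
    WithLp.toLp 2 (U.1.mulVec x.ofLp) ∈ polygonalSphereSet N d := by
  obtain ⟨σ, ε, hU⟩ := exists_mulVec_eq U
  obtain ⟨hnorm, hprod⟩ := hx
  have hε (i : Fin N) : |((ε i : ℤ) : ℝ)| = 1 := by
    rcases Int.units_eq_one_or (ε i) with h | h <;> simp [h]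
  refine ⟨?_, fun i hi => ?_⟩
  · rw [← hnorm, EuclideanSpace.norm_eq, EuclideanSpace.norm_eq]
    simp only [hU, Real.norm_eq_abs, abs_mul, hε, one_mul]
    rw [Equiv.sum_comp σ fun i => |x i| ^ 2]
  · simp only [hU, Finset.prod_mul_distrib]
    exact mul_eq_zero_of_right _ (hprod (σ ∘ i) (σ.injective.comp hi))

/-- The action of the hyperoctahedral group on the polygonal sphere. -/
def act : C(polygonalSphereSet N d, polygonalSphereSet N d) where
  toFun x := ⟨WithLp.toLp 2 (U.1.mulVec x.1.ofLp), mulVec_mem_polygonalSphereSet U x.2⟩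
  continuous_toFun := by
    refine Continuous.subtype_mk ((PiLp.continuous_toLp 2 _).comp ?_) _
    exact continuous_const.matrix_mulVec ((PiLp.continuous_ofLp 2 _).comp continuous_subtype_val)

end hyperoctahedralGroup

/-! ### The actions -/

section actions

variable (τ : TensorKind) (N d : ℕ)

theorem hyperoctahedral_actsOn_polygonalSphere :
    (hyperoctahedral τ N).ActsOn (polygonalSphere N d) := by
  obtain ⟨Φ, hΦ⟩ := exists_starAlgHom_tensor_continuousMap τ
    fun U : hyperoctahedralGroup N =>
      ContinuousMap.compStarAlgHom' ℂ ℂ (hyperoctahedralGroup.act (d := d) U)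
  refine ⟨Φ, fun i => hΦ _ _ _ fun U => ContinuousMap.ext fun x => ?_⟩
  have hact : ((U.1.mulVec x.1.ofLp i : ℝ) : ℂ) = ∑ j, ((U.1 i j : ℝ) : ℂ) * ((x.1 j : ℝ) : ℂ) := by
    simp only [Matrix.mulVec, dotProduct, Complex.ofReal_sum, Complex.ofReal_mul]
  rw [ContinuousMap.sum_apply]
  exact hact

theorem hyperoctahedral_actsOn_twistedPolygonalSphere :
    (hyperoctahedral τ N).ActsOn (twistedPolygonalSphere N d) := by
  have hG := hyperoctahedral_isHigherCubic τ N
  obtain ⟨hanti, hpoly⟩ := satisfies_union.1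
    (SphereSubspace.satisfies_ofRel (anticommRel N ∪ polygonalRel N d))
  exact QuantumSubgroup.actsOn_ofRel _ <| satisfies_union.2
    ⟨hG.satisfies_coact_anticommRel (hyperoctahedral_commute τ N) hanti,
      hG.satisfies_coact_polygonalRel hpoly⟩

theorem halfHyperoctahedral_actsOn_halfPolygonalSphere :
    (halfHyperoctahedral τ N).ActsOn (halfPolygonalSphere N d) := by
  have hG := halfHyperoctahedral_isHigherCubic τ N
  obtain ⟨hGhalf, -⟩ := satisfies_union.1 (halfHyperoctahedral_satisfies τ N)
  obtain ⟨hhalf, hpoly⟩ := satisfies_union.1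
    (SphereSubspace.satisfies_ofRel (halfCommRel (Fin N) ∪ polygonalRel N d))
  exact QuantumSubgroup.actsOn_ofRel _ <| satisfies_union.2
    ⟨hG.satisfies_coact_halfCommRel hGhalf hhalf, hG.satisfies_coact_polygonalRel hpoly⟩

theorem halfHyperoctahedral_actsOn_twistedHalfPolygonalSphere :
    (halfHyperoctahedral τ N).ActsOn (twistedHalfPolygonalSphere N d) := by
  have hG := halfHyperoctahedral_isHigherCubic τ N
  obtain ⟨hGhalf, -⟩ := satisfies_union.1 (halfHyperoctahedral_satisfies τ N)
  obtain ⟨htwisted, hpoly⟩ := satisfies_union.1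
    (SphereSubspace.satisfies_ofRel (twistedHalfCommRel N ∪ polygonalRel N d))
  exact QuantumSubgroup.actsOn_ofRel _ <| satisfies_union.2
    ⟨hG.satisfies_coact_twistedHalfCommRel hGhalf htwisted, hG.satisfies_coact_polygonalRel hpoly⟩

theorem higherHyperoctahedral_actsOn_freePolygonalSphere :
    (higherHyperoctahedral τ N).ActsOn (freePolygonalSphere N d) :=
  QuantumSubgroup.actsOn_ofRel _ <|
    (higherHyperoctahedral_isHigherCubic τ N).satisfies_coact_polygonalRel
      (SphereSubspace.satisfies_ofRel _)

theorem theorem4p5_general :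
    (hyperoctahedral τ N).ActsOn (polygonalSphere N d) ∧
    (hyperoctahedral τ N).ActsOn (twistedPolygonalSphere N d) ∧
    (halfHyperoctahedral τ N).ActsOn (halfPolygonalSphere N d) ∧
    (halfHyperoctahedral τ N).ActsOn (twistedHalfPolygonalSphere N d) ∧
    (higherHyperoctahedral τ N).ActsOn (freePolygonalSphere N d) :=
  ⟨hyperoctahedral_actsOn_polygonalSphere τ N d,
    hyperoctahedral_actsOn_twistedPolygonalSphere τ N d,
    halfHyperoctahedral_actsOn_halfPolygonalSphere τ N d,
    halfHyperoctahedral_actsOn_twistedHalfPolygonalSphere τ N d,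
    higherHyperoctahedral_actsOn_freePolygonalSphere τ N d⟩

end actions

theorem theorem4p5 (τ : TensorKind) (N d : ℕ) (hd : 2 ≤ d) :
    (hyperoctahedral τ N).ActsOn (polygonalSphere N d) ∧
    (hyperoctahedral τ N).ActsOn (twistedPolygonalSphere N d) ∧
    (halfHyperoctahedral τ N).ActsOn (halfPolygonalSphere N d) ∧
    (halfHyperoctahedral τ N).ActsOn (twistedHalfPolygonalSphere N d) ∧
    (higherHyperoctahedral τ N).ActsOn (freePolygonalSphere N d) := by
  exact theorem4p5_general τ N d
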